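/- Let $A\subset\mathbb Z^k$ be a finite set with $|A|>1$, let $P\subset\mathbb R^k$ be its convex hull, and for $\alpha\in\mathbb C^A$ put $f_\alpha(x)=\sum_{a\in A}\alpha_a x^a$ on $(\mathbb C^*)^k$. For a nonempty face $F$ of $P$ (including $P$ itself) put $f^F_\alpha=\sum_{a\in A\cap F}\alpha_a x^a$, and let $V(A)\subset\mathbb C^A$ be the set of those $\alpha$ for which, for some such $F$, the function $f^F_\alpha$ and all its partial derivatives have a common zero in $(\mathbb C^*)^k$. Let $q$ be a positive definite quadratic form on $\mathbb R^k$, let $\psi(x)=q(\log|x_1|,\dots,\log|x_k|)$ be the corresponding toric Kähler potential on $(\mathbb C^*)^k$, and let $\theta=-d\psi\circ J$, $\omega=d\theta$, $g(X,Y)=\omega(X,JY)$, $h=g-i\omega$. Put $$N=\{(\alpha,x)\mid \alpha\in\mathbb C^A\setminus V(A),\ x\in(\mathbb C^*)^k,\ f_\alpha(x)=0\},\qquad N_\alpha=f_\alpha^{-1}(0).$$ A *Liouville manifold* is an exact symplectic manifold $(S,\theta)$ without boundary whose Liouville vector field $Z$ (defined by $i_Z d\theta=\theta$) is complete and which contains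 a *generating Liouville domain*, that is, a compact codimension zero submanifold $M$ with boundary such that $Z$ points outward along $\partial M$ and every point of $S$ is reached from $M$ by the flow of $Z$ in some time $t\ge 0$. Then: 1. $\mathbb C^A\setminus V(A)$ is open, $N$ is a smooth submanifold, the projection $N\to\mathbb C^A\setminus V(A)$ is a surjective submersion, and every fibre $N_\alpha$ with the restriction of $\theta$ is a Liouville manifold; that is, $(N_\alpha)_{\alpha\in\mathbb C^A\setminus V(A)}$ is a family of Liouville manifolds. 2. This family locally has families of generating Liouville domains: every $\alpha_0\in\mathbb C^A\setminus V(A)$ has an open neighbourhood $V\subset\mathbb C^A\setminus V(A)$ for which there is a codimension zero submanifold with boundary $M\subset N|_V$, proper over $V$, such that $M_\alpha$ is a generating Liouville domain of $N_\alpha$ for every $\alpha\in V$. 3. For every compact $K\subset\mathbb C^A\setminus V(A)$ and every $\delta<\pi/2$ there is a compact set $C\subset(\mathbb C^*)^k$ such that for all $\alpha\in K$ and all $x\in f_\alpha^{-1}(0)\setminus C$ the vectors $\operatorname{grad}_g\psi$ and $\partial f_\alpha$ at $x$ are nonzero and the Hermitian angle between them is greater than $\delta$. Here the Hermitian angle $\tau\in[0,\pi/2]$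 of nonzero vectors $X,Y$ is given by $\cos\tau=|h(X,Y)|/(|X||Y|)$, and $\partial f_\alpha$ is regarded as a vector through $X\mapsto h(-,X)$. -/

import Mathlib

open Set Filter Topology
open scoped ContDiff

noncomputable section

/-! ### Embedded submanifolds of normed spaces -/

section Submanifolds

variable {E : Type*} [NormedAddCommGroup E] [NormedSpace ℝ E]

/-- `S` is a (smoothly) embedded submanifold, without boundary, of finite codimension in `E`:
for some `c` it is, near each of its points, the zero set of a smooth map to `ℝ^c` whose
differential at that point is surjective. -/
def IsSmoothSubmanifold (S : Set E) : Prop :=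
  ∃ c : ℕ, ∀ p ∈ S, ∃ U : Set E, IsOpen U ∧ p ∈ U ∧ ∃ g : E → (Fin c → ℝ),
    ContDiffOn ℝ ∞ g U ∧ Function.Surjective (fderiv ℝ g p) ∧ ∀ x ∈ U, x ∈ S ↔ g x = 0

/-- The tangent space `T_p S` of an embedded submanifold `S` of `E`: the vectors killed by the
differentials at `p` of all smooth functions that vanish on `S` near `p`. -/
def submanifoldTangent (S : Set E) (p : E) : Submodule ℝ E where
  carrier := {v | ∀ g : E → ℝ, ContDiffAt ℝ ∞ g p → (∀ᶠ x in 𝓝[S] p, g x = 0) → fderiv ℝ g p v = 0}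
  add_mem' := by
    intro v w hv hw g hg hS
    rw [map_add, hv g hg hS, hw g hg hS, add_zero]
  zero_mem' := by
    intro g _ _
    exact map_zero _
  smul_mem' := by
    intro a v hv g hg hS
    rw [map_smul, hv g hg hS, smul_zero]

/-- The part of `M` along which `M` is not a neighbourhood of the point in `S`. -/
def relBoundary (S M : Set E) : Set E :=
  {p | p ∈ M ∧ ¬ ∀ᶠ x in 𝓝[S] p, x ∈ M}

/-- `h` is a local defining function of `M ⊆ S` at the boundary point `p`: near `p`, the set `M`
is `{h ≤ 0}` inside `S`, and `h` vanishes at `p` with `dh ≠ 0` on `T_p S`. -/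
def IsBoundaryDefining (S M : Set E) (p : E) (h : E → ℝ) : Prop :=
  h p = 0 ∧ (∃ v ∈ submanifoldTangent S p, fderiv ℝ h p v ≠ 0) ∧
    ∃ U : Set E, IsOpen U ∧ p ∈ U ∧ ContDiffOn ℝ ∞ h U ∧ ∀ x ∈ U ∩ S, x ∈ M ↔ h x ≤ 0

/-- `M` is a codimension zero submanifold with (possibly empty) smooth boundary of `S`; its
boundary is then `relBoundary S M`. -/
def IsDomainWithBoundary (S M : Set E) : Prop :=
  M ⊆ S ∧ ∀ p ∈ relBoundary S M, ∃ h, IsBoundaryDefining S M p h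

/-! ### Exact symplectic manifolds and Liouville manifolds -/

/-- The exterior derivative of a one-form on `E`. -/
def dOneForm (θ : E → E →L[ℝ] ℝ) (x : E) : E [⋀^Fin 2]→L[ℝ] ℝ :=
  extDeriv (fun y => ContinuousAlternatingMap.ofSubsingleton ℝ E ℝ (0 : Fin 1) (θ y)) x

theorem dOneForm_apply (θ : E → E →L[ℝ] ℝ) (x : E) (hθ : DifferentiableAt ℝ θ x) (v w : E) :
    dOneForm θ x ![v, w] = fderiv ℝ θ x v w - fderiv ℝ θ x w v := by
  let L : (E →L[ℝ] ℝ) →L[ℝ] (E [⋀^Fin 1]→L[ℝ] ℝ) :=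
    (ContinuousAlternatingMap.ofSubsingletonLIE (𝕜 := ℝ) (E := E) (F := ℝ) (0 : Fin 1)).toContinuousLinearEquiv
  have h : HasFDerivAt (fun y => ContinuousAlternatingMap.ofSubsingleton ℝ E ℝ (0 : Fin 1) (θ y))
      (L.comp (fderiv ℝ θ x)) x := L.hasFDerivAt.comp x hθ.hasFDerivAt
  have hL : ∀ (f : E →L[ℝ] ℝ) (u : Fin 1 → E), L f u = f (u 0) := fun _ _ => rfl
  rw [dOneForm, extDeriv, h.fderiv,
    ContinuousAlternatingMap.alternatizeUncurryFin_apply]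
  simp [Fin.sum_univ_two, hL, Fin.removeNth, sub_eq_add_neg]

/-- `(S, θ|_S)` is an exact symplectic manifold without boundary, where `θ` is a one-form that is
defined and smooth on a neighbourhood of `S` in the ambient space. The exterior derivative of
`θ|_S` is the restriction of `dθ`. -/
structure IsExactSymplectic (S : Set E) (θ : E → E →L[ℝ] ℝ) : Prop where
  submanifold : IsSmoothSubmanifold S
  smooth : ∃ W : Set E, IsOpen W ∧ S ⊆ W ∧ ContDiffOn ℝ ∞ θ W
  nondegenerate : ∀ x ∈ S, ∀ v ∈ submanifoldTangent S x,
    (∀ w ∈ submanifoldTangent S x, dOneForm θ x ![v, w] = 0) → v = 0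

/-- `Z` is the Liouville vector field of `(S, θ|_S)`: it is tangent to `S` and `i_Z dθ = θ` on `S`.
By nondegeneracy its values on `S` are unique. -/
def IsLiouvilleField (S : Set E) (θ : E → E →L[ℝ] ℝ) (Z : E → E) : Prop :=
  ∀ x ∈ S, Z x ∈ submanifoldTangent S x ∧
    ∀ v ∈ submanifoldTangent S x, dOneForm θ x ![Z x, v] = θ x v

/-- `γ : ℝ → E` is a flow line, defined for all times, of `Z` inside `S`. -/
def IsFlowLine (S : Set E) (Z : E → E) (γ : ℝ → E) : Prop :=
  (∀ t, γ t ∈ S) ∧ IsIntegralCurve γ (fun _ => Z)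

/-- The Liouville vector field of `(S, θ|_S)` is complete. -/
def IsLiouvilleComplete (S : Set E) (θ : E → E →L[ℝ] ℝ) : Prop :=
  ∃ Z, IsLiouvilleField S θ Z ∧ ∀ x ∈ S, ∃ γ, IsFlowLine S Z γ ∧ γ 0 = x

/-- `M` is a generating Liouville domain of `(S, θ|_S)`: a compact codimension zero submanifold
with boundary, along whose boundary the Liouville vector field `Z` points outward, and such that
every point of `S` is reached from `M` by the flow of `Z` in some time `t ≥ 0`. -/
def IsGeneratingLiouvilleDomain (S : Set E) (θ : E → E →L[ℝ] ℝ) (M : Set E) : Prop :=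
  IsCompact M ∧ IsDomainWithBoundary S M ∧ ∃ Z, IsLiouvilleField S θ Z ∧
    (∀ p ∈ relBoundary S M, ∃ h, IsBoundaryDefining S M p h ∧ 0 < fderiv ℝ h p (Z p)) ∧
    ∀ x ∈ S, ∃ γ, IsFlowLine S Z γ ∧ γ 0 ∈ M ∧ ∃ t, 0 ≤ t ∧ γ t = x

/-- `(S, θ|_S)` is a Liouville manifold (of finite type): a complete exact symplectic manifold that
contains a generating Liouville domain. -/
structure IsLiouvilleManifold (S : Set E) (θ : E → E →L[ℝ] ℝ) : Prop where
  exactSymplectic : IsExactSymplectic S θ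
  complete : IsLiouvilleComplete S θ
  generated : ∃ M, IsGeneratingLiouvilleDomain S θ M

end Submanifolds

/-! ### Families -/

section Families

variable {F E : Type*} [NormedAddCommGroup F] [NormedSpace ℝ F]
  [NormedAddCommGroup E] [NormedSpace ℝ E]

/-- The fibre over `t` of a subset of `F × E`. -/
def fibreAt (N : Set (F × E)) (t : F) : Set E := {x | (t, x) ∈ N}

/-- The projection `N → B` from the embedded submanifold `N` of `F × E` to the open set `B` of `F`
is a family of Liouville manifolds, where the fibre `N_t` carries the restriction of the one-form
`θ t`: it is a surjective submersion, the forms vary smoothly, and every `(N_t, θ t)` is a Liouville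
manifold. -/
structure IsLiouvilleFamily (B : Set F) (N : Set (F × E)) (θ : F → E → E →L[ℝ] ℝ) : Prop where
  isOpen_base : IsOpen B
  submanifold : IsSmoothSubmanifold N
  surjective : Prod.fst '' N = B
  submersive : ∀ p ∈ N, ∀ u : F, ∃ v ∈ submanifoldTangent N p, v.1 = u
  smooth : ∃ W : Set (F × E), IsOpen W ∧ N ⊆ W ∧ ContDiffOn ℝ ∞ (fun p : F × E => θ p.1 p.2) W
  fibre : ∀ t ∈ B, IsLiouvilleManifold (fibreAt N t) (θ t)

/-- `M` is a family of generating Liouville domains for the part of the family `N` over `V`: a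
codimension zero submanifold with boundary of `N|_V`, proper over `V` (in particular closed in
`N|_V`), each of whose fibres is a generating Liouville domain. -/
structure IsGeneratingDomainFamily (V : Set F) (N : Set (F × E)) (θ : F → E → E →L[ℝ] ℝ)
    (M : Set (F × E)) : Prop where
  domain : IsDomainWithBoundary (N ∩ Prod.fst ⁻¹' V) M
  proper : ∀ K ⊆ V, IsCompact K → IsCompact (M ∩ Prod.fst ⁻¹' K)
  fibre : ∀ t ∈ V, IsGeneratingLiouvilleDomain (fibreAt N t) (θ t) (fibreAt M t)

/-- The family `N → B` has families of generating Liouville domains, locally over `B`. -/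
def LocallyHasGeneratingDomains (B : Set F) (N : Set (F × E)) (θ : F → E → E →L[ℝ] ℝ) : Prop :=
  ∀ b ∈ B, ∃ V ⊆ B, IsOpen V ∧ b ∈ V ∧ ∃ M, IsGeneratingDomainFamily V N θ M

end Families

/-! ### Kähler geometry of the complex torus -/

section Kahler

variable {k : ℕ}

/-- The torus `(ℂ^*)^k` as an open subset of `ℂ^k`. -/
def complexTorus (k : ℕ) : Set (Fin k → ℂ) := {x | ∀ i, x i ≠ 0}

/-- The toric potential `ψ(x) = q(log |x_1|, …, log |x_k|)` of a quadratic form `q`. -/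
def toricPotential (q : QuadraticForm ℝ (Fin k → ℝ)) (x : Fin k → ℂ) : ℝ :=
  q (fun i => Real.log ‖x i‖)

/-- The Liouville form `θ = -dψ ∘ J` of a Kähler potential `ψ`, where `J` is multiplication
by `i`. -/
def kahlerLiouvilleForm (ψ : (Fin k → ℂ) → ℝ) (x : Fin k → ℂ) : (Fin k → ℂ) →L[ℝ] ℝ :=
  -((fderiv ℝ ψ x).comp (Complex.I • ContinuousLinearMap.id ℝ (Fin k → ℂ)))

/-- The Kähler form `ω = dθ`. -/
def kahlerForm (ψ : (Fin k → ℂ) → ℝ) (x v w : Fin k → ℂ) : ℝ :=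
  dOneForm (kahlerLiouvilleForm ψ) x ![v, w]

/-- The Riemannian metric `g(v, w) = ω(v, J w)`. -/
def kahlerMetric (ψ : (Fin k → ℂ) → ℝ) (x v w : Fin k → ℂ) : ℝ :=
  kahlerForm ψ x v (Complex.I • w)

/-- The Hermitian form `h = g - i ω`, linear in the first variable. -/
def kahlerHermitian (ψ : (Fin k → ℂ) → ℝ) (x v w : Fin k → ℂ) : ℂ :=
  (kahlerMetric ψ x v w : ℂ) - Complex.I * (kahlerForm ψ x v w : ℂ)

/-- `Z` is the gradient at `x` of `ψ` for the metric `g`. -/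
def IsKahlerGradient (ψ : (Fin k → ℂ) → ℝ) (x Z : Fin k → ℂ) : Prop :=
  ∀ w, kahlerMetric ψ x Z w = fderiv ℝ ψ x w

/-- `X` is the vector that corresponds to the `ℂ`-linear form `a` under `X ↦ h(-, X)`. -/
def IsHermitianDual (ψ : (Fin k → ℂ) → ℝ) (x : Fin k → ℂ) (a : (Fin k → ℂ) →L[ℂ] ℂ)
    (X : Fin k → ℂ) : Prop :=
  ∀ v, a v = kahlerHermitian ψ x v X

/-- The Hermitian angle in `[0, π/2]` of two nonzero vectors at `x`:
`cos τ = |h(X, Y)| / (|X| |Y|)`. -/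
def hermitianAngle (ψ : (Fin k → ℂ) → ℝ) (x X Y : Fin k → ℂ) : ℝ :=
  Real.arccos (‖kahlerHermitian ψ x X Y‖ /
    (√(kahlerMetric ψ x X X) * √(kahlerMetric ψ x Y Y)))

end Kahler

/-! ### Laurent polynomials -/

section Laurent

variable {k : ℕ}

/-- The Laurent polynomial `f_α(x) = ∑_{a ∈ A} α_a x^a`. -/
def laurentPoly (A : Finset (Fin k → ℤ)) (α : A → ℂ) (x : Fin k → ℂ) : ℂ :=
  ∑ a : A, α a * ∏ i, x i ^ (a.1 i)

/-- A lattice point, viewed in `ℝ^k`. -/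
def latticePoint (a : Fin k → ℤ) : Fin k → ℝ := fun i => (a i : ℝ)

/-- The polytope `P = conv(A)`. -/
def newtonPolytope (A : Finset (Fin k → ℤ)) : Set (Fin k → ℝ) :=
  convexHull ℝ (latticePoint '' (A : Set (Fin k → ℤ)))

/-- `Q` is a nonempty face of `P = conv(A)`; `P` is a face of itself. -/
def IsNewtonFace (A : Finset (Fin k → ℤ)) (Q : Set (Fin k → ℝ)) : Prop :=
  Q.Nonempty ∧ IsExposed ℝ (newtonPolytope A) Q

/-- The coefficients of the face polynomial `f_α^Q = ∑_{a ∈ A ∩ Q} α_a x^a`. -/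
def faceCoeff (A : Finset (Fin k → ℤ)) (Q : Set (Fin k → ℝ)) (α : A → ℂ) : A → ℂ :=
  Set.indicator {a : A | latticePoint a.1 ∈ Q} α

/-- The hypersurface `f_α = 0` has a singular point in the torus. -/
def HasTorusSingularity (A : Finset (Fin k → ℤ)) (α : A → ℂ) : Prop :=
  ∃ x ∈ complexTorus k, laurentPoly A α x = 0 ∧
    ∀ i, fderiv ℂ (laurentPoly A α) x (Pi.single i 1) = 0

/-- The set `V(A)` of the coefficient vectors `α` such that `f_α^Q = 0` has a singular point in the
torus for some face `Q` of `conv(A)`. It is the zero set of the principal `A`-determinant. -/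
def principalLocus (A : Finset (Fin k → ℤ)) : Set (A → ℂ) :=
  {α | ∃ Q, IsNewtonFace A Q ∧ HasTorusSingularity A (faceCoeff A Q α)}

/-- The total space of the family of the hypersurfaces `f_α⁻¹(0) ⊆ (ℂ^*)^k`, for `α ∉ V(A)`. -/
def hypersurfaceFamily (A : Finset (Fin k → ℤ)) : Set ((A → ℂ) × (Fin k → ℂ)) :=
  {p | p.1 ∉ principalLocus A ∧ p.2 ∈ complexTorus k ∧ laurentPoly A p.1 p.2 = 0}

end Laurent

end

/-! In the logarithmic frame `v / x` the Kähler structure of the torus is flat. The metric is the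
Hermitian extension of the polar form of `q`, the gradient of `ψ` is the real vector `u = (log
|x_i|)`, and its squared length is `2ψ`. Write `d` for the vector of logarithmic derivatives of
`f_α`, so that `df_α(v) = d · (v / x)`. The Liouville field of `N_α` is the orthogonal projection of
`u` to the complex hyperplane `d · ξ = 0`. Hence `dψ(Z) = 2ψ - |d · u|² / |d|²`, and the cosine of
the Hermitian angle between `grad ψ` and `∂f_α` is `|d · u| / (|d| √(2ψ))`. The second and third
claims, and the generating domains in the first, follow once the normal component `|d · u| / |d|` is
bounded on `N_α`, locally uniformly in `α`.

Let `S(x) = ∑ |x^a|`. Two estimates give this bound.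

Upper bound, `norm_logGrad_dotProduct_logRadial_le`: on the hypersurface a multiple of `f_α = 0` may
be subtracted from `d · u = ∑ α_a ⟨a, u⟩ x^a`, which replaces `⟨a, u⟩` by `-s` with `s = max ⟨·, u⟩
- ⟨a, u⟩ ≥ 0`. Since `s e^{-s} ≤ 1`, each term is at most `‖α‖ S(x)`.

Lower bound, `exists_lower_bound`: if `α ∉ V(A)`, then `|f_α| + |d| ≥ c S(x)` on the whole torus.
Otherwise some sequence `x_n` violates it with constants tending to zero. The normalised monomials
`x_n^a / S(x_n)` subconverge; the support of the limit is `A ∩ F` for a face `F`, the limit is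
realised up to a factor by a point of the torus, and this point is singular for `f_α^F`. The bound
is stable under small changes of `α` and fails on `V(A)` (`not_lower_bound_of_mem_principalLocus`),
so it also proves that the complement of `V(A)` is open.

Along the Liouville flow `ψ` increases at rate at least `2ψ - D`, so the sublevel sets `{ψ ≤ R}`
with `2R ≥ D + 1` are generating domains, with one `R` for all nearby `α`. Completeness holds
because the field grows at most linearly in the coordinates `log x`. Fibres are nonempty because
`f_α`, restricted to a generic one-parameter subgroup, is a one-variable Laurent polynomial with two
distinct extreme terms, whose coefficients are nonzero off `V(A)`. -/

noncomputable section

/-! ### Global flows and scalar linear differential equations -/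

section GlobalFlow

open scoped Manifold

variable {E : Type*} [NormedAddCommGroup E] [NormedSpace ℝ E]

/-- A `C^1` vector field of linear growth on a finite dimensional space is complete. -/
theorem exists_isIntegralCurve_of_linear_growth [FiniteDimensional ℝ E] {G : E → E}
    (hG : ContDiff ℝ 1 G) {C : ℝ} (hC : 0 ≤ C) (hgrowth : ∀ w, ‖G w‖ ≤ C * ‖w‖) (w₀ : E) :
    ∃ γ : ℝ → E, γ 0 = w₀ ∧ ∀ t, HasDerivAt γ (G (γ t)) t := by
  have : CompleteSpace E := FiniteDimensional.complete ℝ E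
  have : ProperSpace E := FiniteDimensional.proper ℝ E
  -- Local solutions whose lifetime does not depend on the starting point can be continued for all
  -- times. On the ball of radius `1 + ‖x‖` about `x` the field is at most `C (1 + 2‖x‖)`, so the
  -- lifetime `1 / (2C + 1)` works for every `x`.
  obtain ⟨γ, h0, hγ⟩ := exists_isMIntegralCurve_of_isMIntegralCurveOn (I := 𝓘(ℝ, E)) (M := E)
    (v := fun x => G x) (contMDiff_vectorSpace_iff_contDiff.2 hG)
    (ε := 1 / (2 * C + 1)) (by positivity) (fun x => by
      obtain ⟨K, hK⟩ := (hG.contDiffOn (s := Metric.closedBall x (1 + ‖x‖))).exists_lipschitzOnWith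
        one_ne_zero (convex_closedBall _ _) (isCompact_closedBall _ _)
      have hε : (0 : ℝ) ≤ 1 / (2 * C + 1) := by positivity
      have hL : 0 ≤ C * (1 + 2 * ‖x‖) := by positivity
      have ha : 0 ≤ 1 + ‖x‖ := by positivity
      have hP : IsPicardLindelof (fun _ => G) (tmin := -(1 / (2 * C + 1)))
          (tmax := 1 / (2 * C + 1)) ⟨0, by simpa using hε, hε⟩ x ⟨1 + ‖x‖, ha⟩ 0
          ⟨C * (1 + 2 * ‖x‖), hL⟩ K := by
        refine IsPicardLindelof.of_time_independent (fun y hy => ?_) hK ?_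
        · refine (hgrowth y).trans ?_
          have : ‖y - x‖ ≤ 1 + ‖x‖ := mem_closedBall_iff_norm.1 hy
          have h2 : ‖y‖ ≤ ‖y - x‖ + ‖x‖ := by simpa using norm_add_le (y - x) x
          exact mul_le_mul_of_nonneg_left (by linarith) hC
        · simp only [sub_zero, zero_sub, neg_neg, max_self, NNReal.coe_zero]
          change C * (1 + 2 * ‖x‖) * (1 / (2 * C + 1)) ≤ 1 + ‖x‖
          rw [mul_one_div, div_le_iff₀ (by positivity)]
          nlinarith [norm_nonneg x]
      obtain ⟨α, hα0, hα⟩ := hP.exists_eq_forall_mem_Icc_hasDerivWithinAt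
        (Metric.mem_closedBall_self (by simp))
      refine ⟨α, hα0, fun t ht => ?_⟩
      have h1 := (hα t (Ioo_subset_Icc_self ht)).mono Ioo_subset_Icc_self
      exact h1.hasFDerivWithinAt.hasMFDerivWithinAt) w₀
  refine ⟨γ, h0, fun t => ?_⟩
  have h : HasFDerivAt γ (ContinuousLinearMap.toSpanSingleton ℝ (G (γ t))) t :=
    hasMFDerivAt_iff_hasFDerivAt.1 (hγ t)
  exact h.hasDerivAt.congr_deriv (one_smul ℝ _)

/-- A solution of a scalar linear differential equation that vanishes at `0` vanishes. -/
theorem eq_zero_of_hasDerivAt_mul {e κ : ℝ → ℂ} (hκ : Continuous κ)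
    (he : ∀ t, HasDerivAt e (κ t * e t) t) (h0 : e 0 = 0) (t : ℝ) : e t = 0 := by
  have hK : ∀ t, HasDerivAt (fun t => ∫ s in (0 : ℝ)..t, κ s) (κ t) t := fun t =>
    intervalIntegral.integral_hasDerivAt_right (hκ.intervalIntegrable _ _)
      hκ.aestronglyMeasurable.stronglyMeasurableAtFilter hκ.continuousAt
  have hd : ∀ t, HasDerivAt (fun t => Complex.exp (-∫ s in (0 : ℝ)..t, κ s) * e t) 0 t := by
    intro t
    refine ((hK t).neg.cexp.mul (he t)).congr_deriv ?_
    ring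
  have := is_const_of_deriv_eq_zero (fun t => (hd t).differentiableAt) (fun t => (hd t).deriv) t 0
  simpa [h0, Complex.exp_ne_zero] using this

end GlobalFlow

/-! ### The Kähler structure in the logarithmic frame -/

section KahlerFormulas

variable {k : ℕ}

theorem isOpen_complexTorus : IsOpen (complexTorus k) := by
  have : complexTorus k = ⋂ i, {x | x i ≠ 0} := by ext; simp [complexTorus]
  rw [this]
  exact isOpen_iInter_of_finite fun i => isOpen_ne_fun (continuous_apply i) continuous_const

/-- The vector `(log |x_1|, …, log |x_k|)`. -/
def logAbs (x : Fin k → ℂ) : Fin k → ℝ := fun i => Real.log ‖x i‖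

/-- The componentwise real part. -/
def rePart : (Fin k → ℂ) →L[ℝ] (Fin k → ℝ) :=
  ContinuousLinearMap.pi fun i => Complex.reCLM.comp (ContinuousLinearMap.proj i)

/-- The componentwise imaginary part. -/
def imPart : (Fin k → ℂ) →L[ℝ] (Fin k → ℝ) :=
  ContinuousLinearMap.pi fun i => Complex.imCLM.comp (ContinuousLinearMap.proj i)

@[simp] theorem rePart_apply (v : Fin k → ℂ) (i : Fin k) : rePart v i = (v i).re := rfl

@[simp] theorem imPart_apply (v : Fin k → ℂ) (i : Fin k) : imPart v i = (v i).im := rfl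

theorem rePart_I_smul (v : Fin k → ℂ) : rePart (Complex.I • v) = -imPart v := by
  ext i; simp

theorem imPart_I_smul (v : Fin k → ℂ) : imPart (Complex.I • v) = rePart v := by
  ext i; simp

theorem smul_div_pi (c : ℂ) (v x : Fin k → ℂ) : (c • v) / x = c • (v / x) := by
  ext i; simp [mul_div_assoc]

/-- The componentwise division by `x`, which expresses a tangent vector at `x` in logarithmic
coordinates. -/
def logFrame (x : Fin k → ℂ) : (Fin k → ℂ) →L[ℝ] (Fin k → ℂ) :=
  ContinuousLinearMap.pi fun i =>
    ((x i)⁻¹ • ContinuousLinearMap.proj (R := ℂ) (φ := fun _ : Fin k => ℂ) i).restrictScalars ℝ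

theorem logFrame_apply (x v : Fin k → ℂ) : logFrame x v = v / x := by
  ext i; simp [logFrame, div_eq_inv_mul]

theorem hasFDerivAt_log_norm {z : ℂ} (hz : z ≠ 0) :
    HasFDerivAt (fun z : ℂ => Real.log ‖z‖)
      (Complex.reCLM.comp ((z⁻¹ • ContinuousLinearMap.id ℂ ℂ).restrictScalars ℝ)) z := by
  have h1 : HasFDerivAt (fun z : ℂ => ‖z‖ ^ 2) _ z := (hasFDerivAt_id (𝕜 := ℝ) z).norm_sq
  have h2 := (h1.log (by positivity)).const_mul (1 / 2)
  have h3 : (fun z : ℂ => (1 / 2 : ℝ) * Real.log (‖z‖ ^ 2)) = fun z : ℂ => Real.log ‖z‖ := by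
    ext w; rw [Real.log_pow]; push_cast; ring
  rw [h3] at h2
  refine h2.congr_fderiv ?_
  ext w
  have hz' : ‖z‖ ^ 2 ≠ 0 := by positivity
  simp [Complex.inner, Complex.inv_re, Complex.inv_im, Complex.normSq_eq_norm_sq]
  field_simp
  ring

theorem hasFDerivAt_logAbs {x : Fin k → ℂ} (hx : x ∈ complexTorus k) :
    HasFDerivAt logAbs (rePart.comp (logFrame x)) x := by
  rw [hasFDerivAt_pi']
  intro i
  have h := (hasFDerivAt_log_norm (hx i)).comp x
    (ContinuousLinearMap.proj (R := ℝ) (φ := fun _ : Fin k => ℂ) i).hasFDerivAt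
  refine h.congr_fderiv ?_
  ext v
  simp [logFrame_apply, div_eq_inv_mul]

theorem contDiffOn_logAbs : ContDiffOn ℝ ∞ (logAbs (k := k)) (complexTorus k) := by
  rw [contDiffOn_pi]
  intro i x hx
  have h1 : ContDiffAt ℝ ∞ (fun x : Fin k → ℂ => x i) x :=
    (ContinuousLinearMap.proj (R := ℝ) (φ := fun _ : Fin k => ℂ) i).contDiff.contDiffAt
  exact ((h1.norm ℝ (hx i)).log (norm_ne_zero_iff.2 (hx i))).contDiffWithinAt

variable (q : QuadraticForm ℝ (Fin k → ℝ))

/-- The polar form of `q`. -/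
def polarForm : (Fin k → ℝ) →L[ℝ] (Fin k → ℝ) →L[ℝ] ℝ :=
  LinearMap.toContinuousBilinearMap q.polarBilin

theorem polarForm_apply (u v : Fin k → ℝ) : polarForm q u v = QuadraticMap.polar q u v := rfl

theorem polarForm_comm (u v : Fin k → ℝ) : polarForm q u v = polarForm q v u :=
  QuadraticMap.polar_comm q u v

theorem polarForm_self (u : Fin k → ℝ) : polarForm q u u = 2 * q u := by
  rw [polarForm_apply, QuadraticMap.polar_self]; simp

theorem toricPotential_eq (x : Fin k → ℂ) : toricPotential q x = q (logAbs x) := rfl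

theorem toricPotential_eq' :
    toricPotential q = fun x => (1 / 2 : ℝ) * polarForm q (logAbs x) (logAbs x) := by
  ext x; rw [polarForm_self, toricPotential_eq]; ring

theorem contDiffOn_toricPotential : ContDiffOn ℝ ∞ (toricPotential q) (complexTorus k) := by
  rw [toricPotential_eq']
  exact contDiffOn_const.mul
    (((polarForm q).contDiff.comp_contDiffOn contDiffOn_logAbs).clm_apply contDiffOn_logAbs)

theorem fderiv_toricPotential {x : Fin k → ℂ} (hx : x ∈ complexTorus k) (v : Fin k → ℂ) :
    fderiv ℝ (toricPotential q) x v = polarForm q (logAbs x) (rePart (v / x)) := by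
  have h := hasFDerivAt_logAbs hx
  have h2 := ((((polarForm q).hasFDerivAt.comp x h).clm_apply h).const_mul (1 / 2))
  rw [toricPotential_eq']
  have h3 := h2.fderiv
  simp only [Function.comp_apply] at h3
  rw [h3]
  simp [logFrame_apply, polarForm_comm q (rePart (v / x))]
  ring

theorem kahlerLiouvilleForm_apply {x : Fin k → ℂ} (hx : x ∈ complexTorus k) (v : Fin k → ℂ) :
    kahlerLiouvilleForm (toricPotential q) x v = polarForm q (logAbs x) (imPart (v / x)) := by
  simp [kahlerLiouvilleForm, fderiv_toricPotential q hx, smul_div_pi, rePart_I_smul]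

theorem contDiffOn_kahlerLiouvilleForm :
    ContDiffOn ℝ ∞ (kahlerLiouvilleForm (toricPotential q)) (complexTorus k) := by
  have h := (contDiffOn_toricPotential q).fderiv_of_isOpen (m := ∞) isOpen_complexTorus (by simp)
  exact (h.clm_comp contDiffOn_const).neg

/-- The derivative of `θ` has a part from differentiating `log |x|` and a part from differentiating
`w / x`. The latter depends only on the product `(v / x) * (w / x)`, so it is symmetric and
disappears on antisymmetrising. -/
theorem dOneForm_kahlerLiouvilleForm {x : Fin k → ℂ} (hx : x ∈ complexTorus k)
    (v w : Fin k → ℂ) :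
    dOneForm (kahlerLiouvilleForm (toricPotential q)) x ![v, w] =
      polarForm q (rePart (v / x)) (imPart (w / x)) -
        polarForm q (imPart (v / x)) (rePart (w / x)) := by
  have hd : DifferentiableAt ℝ (kahlerLiouvilleForm (toricPotential q)) x :=
    ((contDiffOn_kahlerLiouvilleForm q).contDiffAt
      (isOpen_complexTorus.mem_nhds hx)).differentiableAt (by simp)
  have key : ∀ v w : Fin k → ℂ, fderiv ℝ (kahlerLiouvilleForm (toricPotential q)) x v w =
      polarForm q (rePart (v / x)) (imPart (w / x)) -
        polarForm q (logAbs x) (imPart (v / x * (w / x))) := by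
    intro v w
    have h1 : fderiv ℝ (kahlerLiouvilleForm (toricPotential q)) x v w =
        fderiv ℝ (fun y => kahlerLiouvilleForm (toricPotential q) y w) x v := by
      rw [fderiv_clm_apply hd (differentiableAt_const w)]; simp
    have h2 : (fun y => kahlerLiouvilleForm (toricPotential q) y w) =ᶠ[𝓝 x]
        fun y => polarForm q (logAbs y) (imPart (w / y)) :=
      Filter.eventually_of_mem (isOpen_complexTorus.mem_nhds hx)
        fun y hy => kahlerLiouvilleForm_apply q hy w
    have h3 : HasFDerivAt (fun y => w / y) (-((logFrame x).comp (logFrame (x / w)))) x := by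
      rw [hasFDerivAt_pi']
      intro i
      have hi : HasDerivAt (fun z : ℂ => w i / z) (-(w i / x i ^ 2)) (x i) := by
        have := (hasDerivAt_inv (hx i)).const_mul (w i)
        simpa [div_eq_mul_inv] using this
      refine ((hi.hasFDerivAt.restrictScalars ℝ).comp x
        (ContinuousLinearMap.proj (R := ℝ) (φ := fun _ : Fin k => ℂ) i).hasFDerivAt).congr_fderiv ?_
      ext v
      simp [logFrame_apply]
      field_simp
    have h4 := ((polarForm q).hasFDerivAt.comp x (hasFDerivAt_logAbs hx)).clm_apply
      (imPart.hasFDerivAt.comp x h3)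
    have h5 := h4.fderiv
    simp only [Function.comp_apply] at h5
    rw [h1, h2.fderiv_eq]
    simp only [Function.comp_def] at h4 h5
    rw [h5]
    have h6 : v / (x / w) / x = v / x * (w / x) := by
      ext i; simp only [Pi.div_apply, Pi.mul_apply]; field_simp
    simp [logFrame_apply, h6]
    ring
  rw [dOneForm_apply _ _ hd, key, key, mul_comm (w / x), polarForm_comm q (rePart (w / x))]
  ring

theorem kahlerForm_eq {x : Fin k → ℂ} (hx : x ∈ complexTorus k) (v w : Fin k → ℂ) :
    kahlerForm (toricPotential q) x v w = polarForm q (rePart (v / x)) (imPart (w / x)) -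
        polarForm q (imPart (v / x)) (rePart (w / x)) :=
  dOneForm_kahlerLiouvilleForm q hx v w

theorem kahlerMetric_eq {x : Fin k → ℂ} (hx : x ∈ complexTorus k) (v w : Fin k → ℂ) :
    kahlerMetric (toricPotential q) x v w = polarForm q (rePart (v / x)) (rePart (w / x)) +
        polarForm q (imPart (v / x)) (imPart (w / x)) := by
  rw [kahlerMetric, kahlerForm_eq q hx, smul_div_pi, rePart_I_smul, imPart_I_smul, map_neg,
    sub_neg_eq_add]

end KahlerFormulas

/-! ### Coercivity and inverse of a positive definite form -/

section PositiveDefinite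

variable {k : ℕ} {q : QuadraticForm ℝ (Fin k → ℝ)}

theorem exists_pos_mul_sq_le (hq : q.PosDef) : ∃ c > 0, ∀ u, c * ‖u‖ ^ 2 ≤ q u := by
  have hcont : Continuous fun u => q u := by
    have h : (fun u => q u) = fun u => (1 / 2 : ℝ) * polarForm q u u := by
      ext u; rw [polarForm_self]; ring
    rw [h]
    exact continuous_const.mul ((polarForm q).continuous.clm_apply continuous_id)
  -- The unit sphere is empty exactly when `k = 0`; otherwise the constant is the minimum of `q` on
  -- it.
  rcases (Metric.sphere (0 : Fin k → ℝ) 1).eq_empty_or_nonempty with he | hne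
  · refine ⟨1, one_pos, fun u => ?_⟩
    rcases eq_or_ne u 0 with rfl | hu
    · simp
    · have : (‖u‖⁻¹ • u) ∈ Metric.sphere (0 : Fin k → ℝ) 1 := by
        simp [norm_smul, hu]
      simp [he] at this
  · obtain ⟨u₀, hu₀, hmin⟩ := (isCompact_sphere (0 : Fin k → ℝ) 1).exists_isMinOn hne
      hcont.continuousOn
    have h0 : u₀ ≠ 0 := by
      rintro rfl; simp at hu₀
    refine ⟨q u₀, hq u₀ h0, fun u => ?_⟩
    rcases eq_or_ne u 0 with rfl | hu
    · simp
    · have hm : (‖u‖⁻¹ • u) ∈ Metric.sphere (0 : Fin k → ℝ) 1 := by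
        simp [norm_smul, hu]
      have h1 : q u₀ ≤ q (‖u‖⁻¹ • u) := hmin hm
      rw [QuadraticMap.map_smul] at h1
      have hn : 0 < ‖u‖ := norm_pos_iff.2 hu
      have h2 := mul_le_mul_of_nonneg_right h1 (sq_nonneg ‖u‖)
      refine h2.trans (le_of_eq ?_)
      simp only [smul_eq_mul]
      field_simp

/-- The inverse of the polar form. -/
theorem exists_sharp (hq : q.PosDef) : ∃ T : (Fin k → ℝ) →L[ℝ] (Fin k → ℝ),
    ∀ p v, polarForm q v (T p) = ∑ i, p i * v i := by
  let L : (Fin k → ℝ) →ₗ[ℝ] (Fin k → ℝ) :=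
    LinearMap.pi fun i => (polarForm q (Pi.single i 1)).toLinearMap
  have hL : ∀ v w, polarForm q v w = ∑ i, L w i * v i := by
    intro v w
    have : v = ∑ i, v i • Pi.single (M := fun _ : Fin k => ℝ) i 1 := by
      ext j; simp [Finset.sum_apply, Pi.single_apply]
    conv_lhs => rw [this]
    simp [L, mul_comm]
  have hinj : Function.Injective L := by
    rw [injective_iff_map_eq_zero]
    intro w hw
    by_contra hne
    have h1 := hL w w
    rw [polarForm_self, hw] at h1
    have := hq w hne
    simp at h1
    linarith
  let e := LinearEquiv.ofInjectiveEndo L hinj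
  refine ⟨LinearMap.toContinuousLinearMap e.symm.toLinearMap, fun p v => ?_⟩
  rw [hL]
  have : L (e.symm p) = p := e.apply_symm_apply p
  simp [this]

end PositiveDefinite

/-! ### Laurent monomials on the torus -/

section Monomials

variable {k : ℕ}

/-- The Laurent monomial `x^a`. -/
def laurentMonomial (a : Fin k → ℤ) (x : Fin k → ℂ) : ℂ := ∏ i, x i ^ a i

theorem laurentMonomial_ne_zero (a : Fin k → ℤ) {x : Fin k → ℂ} (hx : x ∈ complexTorus k) :
    laurentMonomial a x ≠ 0 :=
  Finset.prod_ne_zero_iff.2 fun i _ => zpow_ne_zero _ (hx i)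

theorem laurentMonomial_sub (a b : Fin k → ℤ) {x : Fin k → ℂ} (hx : x ∈ complexTorus k) :
    laurentMonomial (a - b) x = laurentMonomial a x / laurentMonomial b x := by
  simp only [laurentMonomial, ← Finset.prod_div_distrib, Pi.sub_apply]
  exact Finset.prod_congr rfl fun i _ => zpow_sub₀ (hx i) _ _

theorem laurentMonomial_mul (a : Fin k → ℤ) (x y : Fin k → ℂ) :
    laurentMonomial a (x * y) = laurentMonomial a x * laurentMonomial a y := by
  simp [laurentMonomial, mul_zpow, Finset.prod_mul_distrib]

theorem laurentMonomial_exp (a : Fin k → ℤ) (w : Fin k → ℂ) :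
    laurentMonomial a (fun i => Complex.exp (w i)) = Complex.exp (∑ i, a i * w i) := by
  rw [laurentMonomial, Complex.exp_sum]
  exact Finset.prod_congr rfl fun i _ => (Complex.exp_int_mul _ _).symm

theorem norm_laurentMonomial (a : Fin k → ℤ) {x : Fin k → ℂ} (hx : x ∈ complexTorus k) :
    ‖laurentMonomial a x‖ = Real.exp (latticePoint a ⬝ᵥ logAbs x) := by
  rw [laurentMonomial, norm_prod, dotProduct, Real.exp_sum]
  refine Finset.prod_congr rfl fun i _ => ?_
  rw [norm_zpow, latticePoint, logAbs, mul_comm, ← Real.rpow_intCast,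
    Real.rpow_def_of_pos (norm_pos_iff.2 (hx i))]

theorem exp_mem_complexTorus (w : Fin k → ℂ) : (fun i => Complex.exp (w i)) ∈ complexTorus k :=
  fun i => Complex.exp_ne_zero (w i)

theorem mul_mem_complexTorus {x y : Fin k → ℂ} (hx : x ∈ complexTorus k)
    (hy : y ∈ complexTorus k) : x * y ∈ complexTorus k :=
  fun i => mul_ne_zero (hx i) (hy i)

theorem contDiffOn_laurentMonomial (a : Fin k → ℤ) :
    ContDiffOn ℂ ∞ (laurentMonomial a) (complexTorus k) := by
  refine contDiffOn_prod fun i _ x hx => ContDiffAt.contDiffWithinAt ?_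
  have h1 : ContDiffAt ℂ ∞ (fun x : Fin k → ℂ => x i) x := (contDiff_apply ℂ ℂ i).contDiffAt
  rcases Int.eq_nat_or_neg (a i) with ⟨n, hn | hn⟩
  · simpa [hn] using h1.pow n
  · simpa [hn] using (h1.inv (hx i)).pow n

theorem hasFDerivAt_laurentMonomial (a : Fin k → ℤ) {x : Fin k → ℂ} (hx : x ∈ complexTorus k) :
    HasFDerivAt (𝕜 := ℂ) (laurentMonomial a)
      (∑ i, (laurentMonomial a x * (a i / x i)) • ContinuousLinearMap.proj i) x := by
  have hi : ∀ i ∈ Finset.univ, HasFDerivAt (𝕜 := ℂ) (fun x : Fin k → ℂ => x i ^ a i)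
      ((a i * x i ^ (a i - 1)) • ContinuousLinearMap.proj i) x := fun i _ =>
    HasDerivAt.comp_hasFDerivAt (h₂ := fun z : ℂ => z ^ a i)
      (f := fun x : Fin k → ℂ => x i) x (hasDerivAt_zpow (a i) (x i) (Or.inl (hx i)))
      (ContinuousLinearMap.proj (R := ℂ) (φ := fun _ : Fin k => ℂ) i).hasFDerivAt
  have h := HasFDerivAt.finsetProd hi
  refine h.congr_fderiv (Finset.sum_congr rfl fun i _ => ?_)
  rw [smul_smul, laurentMonomial, ← Finset.mul_prod_erase _ _ (Finset.mem_univ i),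
    zpow_sub_one₀ (hx i)]
  congr 1
  ring

end Monomials

/-! ### Logarithmic derivatives and bounds by the monomials -/

section LaurentPolynomials

variable {k : ℕ} (A : Finset (Fin k → ℤ))

theorem laurentPoly_eq (α : A → ℂ) (x : Fin k → ℂ) :
    laurentPoly A α x = ∑ a : A, α a * laurentMonomial a.1 x := rfl

/-- The logarithmic derivatives `x_i ∂f_α/∂x_i`. -/
def logGrad (α : A → ℂ) (x : Fin k → ℂ) : Fin k → ℂ :=
  fun i => ∑ a : A, α a * (a.1 i * laurentMonomial a.1 x)

/-- The sum of the absolute values of the monomials. -/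
def monomialSum (x : Fin k → ℂ) : ℝ := ∑ a : A, ‖laurentMonomial a.1 x‖

theorem hasFDerivAt_laurentPoly (α : A → ℂ) {x : Fin k → ℂ} (hx : x ∈ complexTorus k) :
    HasFDerivAt (𝕜 := ℂ) (laurentPoly A α)
      (∑ i, (logGrad A α x i / x i) • ContinuousLinearMap.proj i) x := by
  have h := HasFDerivAt.fun_sum (u := Finset.univ) fun (a : A) _ =>
    (hasFDerivAt_laurentMonomial a.1 hx).const_mul (α a)
  refine h.congr_fderiv ?_
  ext v
  simp only [FunLike.coe_sum, Finset.sum_apply, 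
    FunLike.coe_smul, Pi.smul_apply, ContinuousLinearMap.proj_apply, smul_eq_mul,
    logGrad, Finset.mul_sum, Finset.sum_div, Finset.sum_mul]
  rw [Finset.sum_comm]
  exact Finset.sum_congr rfl fun i _ => Finset.sum_congr rfl fun a _ => by ring

theorem fderiv_laurentPoly (α : A → ℂ) {x : Fin k → ℂ} (hx : x ∈ complexTorus k)
    (v : Fin k → ℂ) :
    fderiv ℂ (laurentPoly A α) x v = ∑ i, logGrad A α x i * (v / x) i := by
  rw [(hasFDerivAt_laurentPoly A α hx).fderiv]
  simp only [FunLike.coe_sum, Finset.sum_apply, smul_apply,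
    ContinuousLinearMap.proj_apply, smul_eq_mul, Pi.div_apply]
  exact Finset.sum_congr rfl fun i _ => by ring

/-- The partial derivatives are the logarithmic ones divided by the nonzero coordinates. -/
theorem hasTorusSingularity_iff (α : A → ℂ) : HasTorusSingularity A α ↔
    ∃ x ∈ complexTorus k, laurentPoly A α x = 0 ∧ logGrad A α x = 0 := by
  refine exists_congr fun x => and_congr_right fun hx => and_congr_right fun _ => ?_
  rw [funext_iff]
  refine forall_congr' fun i => ?_
  rw [fderiv_laurentPoly A α hx, Finset.sum_eq_single i]
  · simp [hx i]
  · intro j _ hj; simp [hj]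
  · simp

theorem contDiffOn_laurentPoly :
    ContDiffOn ℝ ∞ (fun p : (A → ℂ) × (Fin k → ℂ) => laurentPoly A p.1 p.2)
      (univ ×ˢ complexTorus k) := by
  simp only [laurentPoly_eq]
  refine ContDiffOn.sum fun a _ => ContDiffOn.mul ?_ ?_
  · exact ((contDiff_apply ℝ ℂ a).comp contDiff_fst).contDiffOn
  · exact ((contDiffOn_laurentMonomial a.1).restrict_scalars ℝ).comp contDiffOn_snd
      fun p hp => hp.2

theorem contDiffOn_logGrad (α : A → ℂ) :
    ContDiffOn ℝ ∞ (logGrad A α) (complexTorus k) :=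
  contDiffOn_pi.2 fun _ => ContDiffOn.sum fun a _ => contDiffOn_const.mul
    (contDiffOn_const.mul ((contDiffOn_laurentMonomial a.1).restrict_scalars ℝ))

theorem fderiv_laurentPoly_prod (p : (A → ℂ) × (Fin k → ℂ)) (hp : p.2 ∈ complexTorus k)
    (v : (A → ℂ) × (Fin k → ℂ)) :
    fderiv ℝ (fun p : (A → ℂ) × (Fin k → ℂ) => laurentPoly A p.1 p.2) p v =
      laurentPoly A v.1 p.2 + ∑ i, logGrad A p.1 p.2 i * (v.2 / p.2) i := by
  have hd : DifferentiableAt ℝ (fun p : (A → ℂ) × (Fin k → ℂ) => laurentPoly A p.1 p.2) p :=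
    ((contDiffOn_laurentPoly A).contDiffAt ((isOpen_univ.prod isOpen_complexTorus).mem_nhds
      ⟨mem_univ _, hp⟩)).differentiableAt (by simp)
  have h1 : fderiv ℝ (fun p : (A → ℂ) × (Fin k → ℂ) => laurentPoly A p.1 p.2) p (v.1, 0) =
      laurentPoly A v.1 p.2 := by
    let L : (A → ℂ) →ₗ[ℝ] ℂ :=
      { toFun := fun β => laurentPoly A β p.2
        map_add' := fun β γ => by simp [laurentPoly, add_mul, Finset.sum_add_distrib]
        map_smul' := fun c β => by simp [laurentPoly, Finset.mul_sum, mul_assoc] }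
    have h := hd.hasFDerivAt.comp p.1 (hasFDerivAt_prodMk_left (𝕜 := ℝ) p.1 p.2)
    have h' := (LinearMap.toContinuousLinearMap L).hasFDerivAt (x := p.1)
    have := congrArg (fun T => T v.1) (h.unique h')
    simp only [ContinuousLinearMap.comp_apply, ContinuousLinearMap.inl_apply] at this
    exact this
  have h2 : fderiv ℝ (fun p : (A → ℂ) × (Fin k → ℂ) => laurentPoly A p.1 p.2) p (0, v.2) =
      ∑ i, logGrad A p.1 p.2 i * (v.2 / p.2) i := by
    have h := hd.hasFDerivAt.comp p.2 (hasFDerivAt_prodMk_right (𝕜 := ℝ) p.1 p.2)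
    have h' := (hasFDerivAt_laurentPoly A p.1 hp).restrictScalars ℝ
    have := congrArg (fun T => T v.2) (h.unique h')
    rw [← fderiv_laurentPoly A p.1 hp, (hasFDerivAt_laurentPoly A p.1 hp).fderiv]
    simpa using this
  rw [← h1, ← h2, ← map_add]
  simp

theorem monomialSum_pos (hA : A.Nonempty) {x : Fin k → ℂ} (hx : x ∈ complexTorus k) :
    0 < monomialSum A x := by
  have : Nonempty A := hA.to_subtype
  exact Finset.sum_pos (fun a _ => norm_pos_iff.2 (laurentMonomial_ne_zero a.1 hx))
    Finset.univ_nonempty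

theorem norm_laurentMonomial_le_monomialSum (a : A) (x : Fin k → ℂ) :
    ‖laurentMonomial a.1 x‖ ≤ monomialSum A x :=
  Finset.single_le_sum (f := fun a : A => ‖laurentMonomial a.1 x‖) (fun _ _ => norm_nonneg _)
    (Finset.mem_univ a)

theorem norm_laurentPoly_le (α : A → ℂ) (x : Fin k → ℂ) :
    ‖laurentPoly A α x‖ ≤ ‖α‖ * monomialSum A x := by
  rw [laurentPoly_eq, monomialSum, Finset.mul_sum]
  refine norm_sum_le_of_le _ fun a _ => ?_
  rw [norm_mul]
  exact mul_le_mul_of_nonneg_right (norm_le_pi_norm α a) (norm_nonneg _)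

theorem exists_norm_logGrad_le : ∃ C ≥ 0, ∀ (α : A → ℂ) (x : Fin k → ℂ),
    ‖logGrad A α x‖ ≤ C * ‖α‖ * monomialSum A x := by
  refine ⟨∑ a : A, ‖fun i => (a.1 i : ℂ)‖, by positivity, fun α x => ?_⟩
  have hS : 0 ≤ monomialSum A x := Finset.sum_nonneg fun _ _ => norm_nonneg _
  rw [pi_norm_le_iff_of_nonneg (by positivity)]
  intro i
  rw [logGrad, Finset.sum_mul, Finset.sum_mul]
  refine norm_sum_le_of_le _ fun a _ => ?_
  rw [norm_mul, norm_mul]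
  calc ‖α a‖ * (‖(a.1 i : ℂ)‖ * ‖laurentMonomial a.1 x‖)
      ≤ ‖α‖ * (‖fun i => (a.1 i : ℂ)‖ * monomialSum A x) := by
        gcongr
        · exact norm_le_pi_norm α a
        · exact norm_le_pi_norm (fun i => (a.1 i : ℂ)) i
        · exact norm_laurentMonomial_le_monomialSum A a x
    _ = _ := by ring

theorem laurentPoly_sub (α β : A → ℂ) (x : Fin k → ℂ) :
    laurentPoly A (α - β) x = laurentPoly A α x - laurentPoly A β x := by
  simp [laurentPoly, sub_mul, Finset.sum_sub_distrib]

theorem logGrad_sub (α β : A → ℂ) (x : Fin k → ℂ) :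
    logGrad A (α - β) x = logGrad A α x - logGrad A β x := by
  ext i; simp [logGrad, sub_mul, Finset.sum_sub_distrib]

end LaurentPolynomials

/-! ### Faces as maximum loci of linear functionals, and degeneration along them -/

section Faces

variable {k : ℕ} (A : Finset (Fin k → ℤ))

theorem exists_functional_of_isNewtonFace {Q : Set (Fin k → ℝ)} (hQ : IsNewtonFace A Q) :
    ∃ (l : Fin k → ℝ) (a₀ : A), (∀ a : A, latticePoint a.1 ⬝ᵥ l ≤ latticePoint a₀.1 ⬝ᵥ l) ∧
      ∀ a : A, latticePoint a.1 ∈ Q ↔ latticePoint a.1 ⬝ᵥ l = latticePoint a₀.1 ⬝ᵥ l := by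
  obtain ⟨hne, hexp⟩ := hQ
  obtain ⟨L, hL⟩ := hexp hne
  have hdot : ∀ y, L y = y ⬝ᵥ fun i => L (Pi.single i 1) := by
    intro y
    have : y = ∑ i, y i • Pi.single (M := fun _ : Fin k => ℝ) i 1 := by
      ext j; simp [Finset.sum_apply, Pi.single_apply]
    conv_lhs => rw [this]
    simp [dotProduct]
  have hAne : Nonempty A := by
    obtain ⟨y, hy⟩ := hne
    rw [hL] at hy
    have h1 : (newtonPolytope A).Nonempty := ⟨y, hy.1⟩
    rw [newtonPolytope, convexHull_nonempty_iff, image_nonempty] at h1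
    exact h1.to_subtype
  obtain ⟨a₀, -, hmax⟩ := Finset.exists_max_image (Finset.univ : Finset A)
    (fun a => L (latticePoint a.1)) Finset.univ_nonempty
  have hP : ∀ z ∈ newtonPolytope A, L z ≤ L (latticePoint a₀.1) := by
    have : newtonPolytope A ⊆ {z | L z ≤ L (latticePoint a₀.1)} := by
      refine convexHull_min ?_ (convex_halfSpace_le L.toLinearMap.isLinear _)
      rintro _ ⟨a, ha, rfl⟩
      exact hmax ⟨a, ha⟩ (Finset.mem_univ _)
    exact fun z hz => this hz
  have hmem : ∀ a : A, latticePoint a.1 ∈ newtonPolytope A := fun a =>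
    subset_convexHull _ _ (mem_image_of_mem _ a.2)
  refine ⟨fun i => L (Pi.single i 1), a₀, fun a => ?_, fun a => ?_⟩
  · rw [← hdot, ← hdot]; exact hmax a (Finset.mem_univ _)
  · rw [← hdot, ← hdot, hL]
    constructor
    · rintro ⟨-, h⟩
      exact le_antisymm (hP _ (hmem a)) (h _ (hmem a₀))
    · intro h
      exact ⟨hmem a, fun z hz => h ▸ hP z hz⟩

theorem exists_isNewtonFace_of_functional (l : Fin k → ℝ) (a₀ : A)
    (hmax : ∀ a : A, latticePoint a.1 ⬝ᵥ l ≤ latticePoint a₀.1 ⬝ᵥ l) :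
    ∃ Q, IsNewtonFace A Q ∧
      ∀ a : A, latticePoint a.1 ∈ Q ↔ latticePoint a.1 ⬝ᵥ l = latticePoint a₀.1 ⬝ᵥ l := by
  let L : (Fin k → ℝ) →L[ℝ] ℝ := LinearMap.toContinuousLinearMap
    { toFun := fun y => y ⬝ᵥ l
      map_add' := fun y z => add_dotProduct y z l
      map_smul' := fun c y => smul_dotProduct c y l }
  have hL : ∀ y, L y = y ⬝ᵥ l := fun _ => rfl
  have hP : ∀ z ∈ newtonPolytope A, L z ≤ L (latticePoint a₀.1) := by
    have : newtonPolytope A ⊆ {z | L z ≤ L (latticePoint a₀.1)} := by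
      refine convexHull_min ?_ (convex_halfSpace_le L.toLinearMap.isLinear _)
      rintro _ ⟨a, ha, rfl⟩
      exact hmax ⟨a, ha⟩
    exact fun z hz => this hz
  have hmem : ∀ a : A, latticePoint a.1 ∈ newtonPolytope A := fun a =>
    subset_convexHull _ _ (mem_image_of_mem _ a.2)
  refine ⟨{x ∈ newtonPolytope A | ∀ y ∈ newtonPolytope A, L y ≤ L x},
    ⟨⟨_, hmem a₀, hP⟩, fun _ => ⟨L, rfl⟩⟩, fun a => ?_⟩
  rw [← hL, ← hL]
  constructor
  · rintro ⟨-, h⟩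
    exact le_antisymm (hP _ (hmem a)) (h _ (hmem a₀))
  · intro h
    exact ⟨hmem a, fun z hz => h ▸ hP z hz⟩

open Classical in
/-- A sum of exponentials with nonpositive exponents tends to its constant part. -/
theorem tendsto_sum_mul_exp {ι E : Type*} [Fintype ι] [NormedAddCommGroup E] [NormedSpace ℝ E]
    (b : ι → E) (e : ι → ℝ) (he : ∀ a, e a ≤ 0) :
    Tendsto (fun t : ℝ => ∑ a, Real.exp (t * e a) • b a) atTop
      (𝓝 (∑ a, if e a = 0 then b a else 0)) := by
  refine tendsto_finsetSum _ fun a _ => ?_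
  split_ifs with h
  · simp [h]
  · have h1 : Tendsto (fun t : ℝ => Real.exp (t * e a)) atTop (𝓝 0) :=
      Real.tendsto_exp_atBot.comp
        (tendsto_id.atTop_mul_const_of_neg (lt_of_le_of_ne (he a) h))
    simpa using h1.smul_const (b a)

/-- At coefficient vectors of the principal locus, the polynomial and its logarithmic derivatives
are not uniformly bounded below by the monomials. -/
theorem not_lower_bound_of_mem_principalLocus {α : A → ℂ} (hα : α ∈ principalLocus A) {c : ℝ}
    (hc : 0 < c) (h : ∀ x ∈ complexTorus k,
      c * monomialSum A x ≤ ‖laurentPoly A α x‖ + ‖logGrad A α x‖) : False := by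
  classical
  obtain ⟨Q, hQ, hsing⟩ := hα
  obtain ⟨x, hx, hf, hd⟩ := (hasTorusSingularity_iff A _).1 hsing
  obtain ⟨l, a₀, hmax, hface⟩ := exists_functional_of_isNewtonFace A hQ
  let e : A → ℝ := fun a => latticePoint a.1 ⬝ᵥ l - latticePoint a₀.1 ⬝ᵥ l
  have he : ∀ a, e a ≤ 0 := fun a => sub_nonpos.2 (hmax a)
  have he0 : ∀ a, e a = 0 ↔ latticePoint a.1 ∈ Q := fun a => by rw [hface, sub_eq_zero]
  -- Move the singular point `x` of the face polynomial along the one-parameter group of `l`. After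
  -- division by `s t`, the growth rate of the monomials of the face, all other monomials die out.
  -- Then `f` and its logarithmic derivatives tend to those of the face polynomial, which vanish,
  -- while the monomial sum keeps a positive limit.
  let y : ℝ → Fin k → ℂ := fun t => x * fun i => Complex.exp ((t * l i : ℝ))
  have hy : ∀ t, y t ∈ complexTorus k := fun t =>
    mul_mem_complexTorus hx (exp_mem_complexTorus _)
  let s : ℝ → ℝ := fun t => Real.exp (t * (latticePoint a₀.1 ⬝ᵥ l))
  have hs : ∀ t, 0 < s t := fun t => Real.exp_pos _
  have hmon : ∀ t (a : A), laurentMonomial a.1 (y t) =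
      s t • Real.exp (t * e a) • laurentMonomial a.1 x := by
    intro t a
    have h1 : ∑ i, (a.1 i : ℂ) * ((t * l i : ℝ) : ℂ) =
        ((t * (latticePoint a₀.1 ⬝ᵥ l) + t * e a : ℝ) : ℂ) := by
      rw [← mul_add, add_sub_cancel, dotProduct, Finset.mul_sum]
      push_cast [latticePoint]
      exact Finset.sum_congr rfl fun i _ => by ring
    rw [laurentMonomial_mul, laurentMonomial_exp, h1, ← Complex.ofReal_exp, Real.exp_add,
      smul_smul, Complex.real_smul, mul_comm]
  have hlimf := tendsto_sum_mul_exp (fun a : A => α a * laurentMonomial a.1 x) e he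
  have hlimd : ∀ i, _ := fun i => tendsto_sum_mul_exp
    (fun a : A => α a * (a.1 i * laurentMonomial a.1 x)) e he
  have hlimS := tendsto_sum_mul_exp (fun a : A => ‖laurentMonomial a.1 x‖) e he
  have hf0 : (∑ a, if e a = 0 then α a * laurentMonomial a.1 x else 0) = 0 := by
    refine Eq.trans (Finset.sum_congr rfl fun a _ => ?_) hf
    by_cases ha : latticePoint a.1 ∈ Q <;> simp [he0, faceCoeff, ha, Set.indicator, laurentMonomial]
  have hd0 : ∀ i, (∑ a, if e a = 0 then α a * (a.1 i * laurentMonomial a.1 x) else 0) = 0 := by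
    intro i
    refine Eq.trans (Finset.sum_congr rfl fun a _ => ?_) (congrFun hd i)
    by_cases ha : latticePoint a.1 ∈ Q <;> simp [he0, faceCoeff, ha, Set.indicator]
  simp only [hd0] at hlimd
  rw [hf0] at hlimf
  have hlim2 := (hlimf.norm.add (tendsto_pi_nhds.2 hlimd).norm)
  have hle := le_of_tendsto_of_tendsto (hlimS.const_mul c) hlim2 (Eventually.of_forall fun t => by
    have h1 := h (y t) (hy t)
    have e1 : monomialSum A (y t) =
        s t * ∑ a : A, Real.exp (t * e a) • ‖laurentMonomial a.1 x‖ := by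
      simp only [monomialSum, hmon, norm_smul, Finset.mul_sum, smul_eq_mul,
        Real.norm_of_nonneg (Real.exp_pos _).le, Real.norm_of_nonneg (hs t).le]
    have e2 : laurentPoly A α (y t) =
        s t • ∑ a : A, Real.exp (t * e a) • (α a * laurentMonomial a.1 x) := by
      simp only [laurentPoly_eq, hmon, Finset.smul_sum, mul_smul_comm]
    have e3 : logGrad A α (y t) = s t • fun i =>
        ∑ a : A, Real.exp (t * e a) • (α a * (a.1 i * laurentMonomial a.1 x)) := by
      ext i
      simp only [logGrad, hmon, Finset.smul_sum, mul_smul_comm, Pi.smul_apply]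
    rw [e1, e2, e3, norm_smul, norm_smul, Real.norm_of_nonneg (hs t).le, mul_left_comm,
      ← mul_add] at h1
    exact le_of_mul_le_mul_left h1 (hs t))
  have hpos : 0 < ∑ a : A, if e a = 0 then ‖laurentMonomial a.1 x‖ else 0 := by
    refine Finset.sum_pos' (fun a _ => by split_ifs <;> positivity) ⟨a₀, Finset.mem_univ _, ?_⟩
    simp [e, laurentMonomial_ne_zero a₀.1 hx]
  have : (‖fun _ : Fin k => (0 : ℂ)‖ : ℝ) = 0 := norm_zero
  rw [norm_zero, this, add_zero] at hle
  exact absurd hle (not_le.2 (mul_pos hc hpos))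

end Faces

/-! ### The lower bound that characterises the complement of the principal locus -/

section LowerBound

variable {k : ℕ} (A : Finset (Fin k → ℤ))

/-- This replaces a vector `u` by `T (L u)`, which has the same image under `L` but depends only on
that image. Thus `T (L u_n)` converges whenever `L u_n` does, even if `u_n` is unbounded. -/
theorem LinearMap.exists_generalized_inverse {V W : Type*} [AddCommGroup V] [Module ℝ V]
    [AddCommGroup W] [Module ℝ W] (L : V →ₗ[ℝ] W) : ∃ T : W →ₗ[ℝ] V, ∀ v, L (T (L v)) = L v := by
  obtain ⟨g, hg⟩ := L.rangeRestrict.exists_rightInverse_of_surjective L.range_rangeRestrict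
  obtain ⟨T, hT⟩ := LinearMap.exists_extend g
  refine ⟨T, fun v => ?_⟩
  have h1 : T (L v) = g (L.rangeRestrict v) := LinearMap.congr_fun hT (L.rangeRestrict v)
  have h2 : L.rangeRestrict (g (L.rangeRestrict v)) = L.rangeRestrict v := LinearMap.congr_fun hg _
  rw [h1]
  exact congrArg Subtype.val h2

/-- Off the principal locus, the polynomial and its logarithmic derivatives are uniformly bounded
below by the monomials. -/
theorem exists_lower_bound (hA : A.Nonempty) {α : A → ℂ} (hα : α ∉ principalLocus A) :
    ∃ c > 0, ∀ x ∈ complexTorus k,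
      c * monomialSum A x ≤ ‖laurentPoly A α x‖ + ‖logGrad A α x‖ := by
  classical
  by_contra! hcon
  choose x hx hlt using fun n : ℕ => hcon (1 / ((n : ℝ) + 1)) (by positivity)
  apply hα
  have hS : ∀ n, 0 < monomialSum A (x n) := fun n => monomialSum_pos A hA (hx n)
  -- The normalised monomials and the phases of `x_n` stay in a compact set; the moduli are the only
  -- part of `x_n` that may escape.
  let r : ℕ → A → ℂ := fun n a => laurentMonomial a.1 (x n) / (monomialSum A (x n) : ℂ)
  have hr : ∀ n a, ‖r n a‖ = ‖laurentMonomial a.1 (x n)‖ / monomialSum A (x n) := fun n a => by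
    simp [r, abs_of_pos (hS n)]
  let y : ℕ → Fin k → ℂ := fun n i => x n i / (‖x n i‖ : ℂ)
  have hy1 : ∀ n i, ‖y n i‖ = 1 := fun n i => by
    simp [y, div_self (norm_ne_zero_iff.2 (hx n i))]
  have hbd : ∀ n, (r n, y n) ∈ Metric.closedBall (0 : (A → ℂ) × (Fin k → ℂ)) 1 := by
    intro n
    rw [mem_closedBall_zero_iff, Prod.norm_def, max_le_iff]
    refine ⟨(pi_norm_le_iff_of_nonneg zero_le_one).2 fun a => ?_,
      (pi_norm_le_iff_of_nonneg zero_le_one).2 fun i => (hy1 n i).le⟩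
    change ‖r n a‖ ≤ 1
    rw [hr, div_le_one (hS n)]
    exact norm_laurentMonomial_le_monomialSum A a _
  obtain ⟨⟨r₀, y₀⟩, -, φ, hφ, hlim⟩ := (isCompact_closedBall _ _).tendsto_subseq hbd
  have hr₀ : ∀ a, Tendsto (fun n => r (φ n) a) atTop (𝓝 (r₀ a)) :=
    tendsto_pi_nhds.1 ((continuous_fst.tendsto _).comp hlim)
  have hy₀ : ∀ i, Tendsto (fun n => y (φ n) i) atTop (𝓝 (y₀ i)) :=
    tendsto_pi_nhds.1 ((continuous_snd.tendsto _).comp hlim)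
  have hy₀t : y₀ ∈ complexTorus k := fun i h0 => by
    have h1 := (hy₀ i).norm
    simp only [hy1, h0, norm_zero] at h1
    exact one_ne_zero (tendsto_nhds_unique tendsto_const_nhds h1)
  have hsum1 : ∑ a, ‖r₀ a‖ = 1 := by
    refine tendsto_nhds_unique (tendsto_finsetSum _ fun a _ => (hr₀ a).norm) ?_
    have : ∀ n, ∑ a, ‖r (φ n) a‖ = 1 := fun n => by
      simp only [hr, ← Finset.sum_div]
      exact div_self (hS _).ne'
    exact tendsto_const_nhds.congr fun n => (this n).symm
  have hzero : ∀ F : ℕ → ℂ, (∀ n, ‖F n‖ ≤ ‖laurentPoly A α (x n)‖ + ‖logGrad A α (x n)‖) →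
      Tendsto (fun n => F (φ n) / (monomialSum A (x (φ n)) : ℂ)) atTop (𝓝 0) := by
    intro F hF
    rw [tendsto_zero_iff_norm_tendsto_zero]
    refine squeeze_zero (fun _ => norm_nonneg _) (fun n => ?_)
      (tendsto_one_div_add_atTop_nhds_zero_nat.comp hφ.tendsto_atTop)
    rw [norm_div, Complex.norm_real, Real.norm_of_nonneg (hS _).le, div_le_iff₀ (hS _)]
    exact (hF _).trans (hlt _).le
  have hf0 : ∑ a, α a * r₀ a = 0 := by
    refine tendsto_nhds_unique (tendsto_finsetSum _ fun a _ => (hr₀ a).const_mul (α a)) ?_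
    refine (hzero (fun n => laurentPoly A α (x n)) fun n =>
      le_add_of_nonneg_right (norm_nonneg _)).congr fun n => ?_
    simp [laurentPoly_eq, r, Finset.sum_div, mul_div_assoc]
  have hd0 : ∀ i, ∑ a, α a * (a.1 i * r₀ a) = 0 := by
    intro i
    refine tendsto_nhds_unique (tendsto_finsetSum _ fun a _ =>
      ((hr₀ a).const_mul _).const_mul (α a)) ?_
    refine (hzero (fun n => logGrad A α (x n) i) fun n =>
      (norm_le_pi_norm _ i).trans (le_add_of_nonneg_left (norm_nonneg _))).congr fun n => ?_
    simp [logGrad, r, Finset.sum_div, mul_div_assoc]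
  obtain ⟨b, hb⟩ : ∃ b, r₀ b ≠ 0 := by
    by_contra! h
    simp [h] at hsum1
  have hratio : ∀ n (a : A), laurentMonomial (a.1 - b.1) (x n) = r n a / r n b := by
    intro n a
    rw [laurentMonomial_sub _ _ (hx n)]
    exact (div_div_div_cancel_right₀ (Complex.ofReal_ne_zero.2 (hS n).ne') _ _).symm
  have hrlim : ∀ a, Tendsto (fun n => r (φ n) a / r (φ n) b) atTop (𝓝 (r₀ a / r₀ b)) :=
    fun a => (hr₀ a).div (hr₀ b) hb
  have hexp : ∀ n (a : A),
      Real.exp (latticePoint (a.1 - b.1) ⬝ᵥ logAbs (x n)) = ‖r n a / r n b‖ := fun n a => by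
    rw [← norm_laurentMonomial _ (hx n), hratio]
  -- `L` records the exponents that survive in the limit, relative to a surviving one `b`; rows with
  -- `r₀ a = 0` are set to zero. The values of `L` at `log |x_n|` converge, so `s n` is the
  -- convergent part of `log |x_n|`, and the remainder is invisible to the surviving ratios.
  let L : (Fin k → ℝ) →ₗ[ℝ] (A → ℝ) := LinearMap.pi fun a =>
    if r₀ a = 0 then 0 else
      { toFun := fun u => latticePoint (a.1 - b.1) ⬝ᵥ u
        map_add' := fun u v => dotProduct_add _ u v
        map_smul' := fun c u => dotProduct_smul c _ u }
  have hL : ∀ u a, r₀ a ≠ 0 → L u a = latticePoint (a.1 - b.1) ⬝ᵥ u := fun u a ha => by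
    simp [L, ha]
  obtain ⟨T, hT⟩ := L.exists_generalized_inverse
  let s : ℕ → Fin k → ℝ := fun n => T (L (logAbs (x (φ n))))
  obtain ⟨s₀, hs₀⟩ : ∃ s₀, Tendsto s atTop (𝓝 s₀) := by
    have : Tendsto (fun n => L (logAbs (x (φ n)))) atTop
        (𝓝 fun a => if r₀ a = 0 then 0 else Real.log ‖r₀ a / r₀ b‖) := by
      refine tendsto_pi_nhds.2 fun a => ?_
      split_ifs with ha
      · simp [L, ha]
      · have h1 := (hrlim a).norm.log (norm_ne_zero_iff.2 (div_ne_zero ha hb))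
        refine h1.congr fun n => ?_
        rw [hL _ _ ha, ← hexp, Real.log_exp]
    exact ⟨_, ((LinearMap.toContinuousLinearMap T).continuous.tendsto _).comp this⟩
  have hsdot : ∀ n a, r₀ a ≠ 0 → latticePoint (a.1 - b.1) ⬝ᵥ s n =
      latticePoint (a.1 - b.1) ⬝ᵥ logAbs (x (φ n)) := fun n a ha => by
    rw [← hL _ _ ha, ← hL _ _ ha, hT]
  let z : ℕ → Fin k → ℂ := fun n => (fun i => Complex.exp (s n i)) * y (φ n)
  -- The limit point combines the convergent part of the moduli with the limiting phases. Its
  -- monomials with exponents in the support of `r₀` are proportional to `r₀`.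
  let z₀ : Fin k → ℂ := (fun i => Complex.exp (s₀ i)) * y₀
  have hz₀ : z₀ ∈ complexTorus k := mul_mem_complexTorus (exp_mem_complexTorus _) hy₀t
  have hzlim : Tendsto z atTop (𝓝 z₀) := by
    refine tendsto_pi_nhds.2 fun i => Tendsto.mul ?_ (hy₀ i)
    exact (Complex.continuous_exp.tendsto _).comp
      ((Complex.continuous_ofReal.tendsto _).comp (tendsto_pi_nhds.1 hs₀ i))
  have hmonreal : ∀ (c : Fin k → ℤ) (u : Fin k → ℝ),
      laurentMonomial c (fun i => Complex.exp (u i)) = (Real.exp (latticePoint c ⬝ᵥ u) : ℂ) := by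
    intro c u
    rw [laurentMonomial_exp, Complex.ofReal_exp]
    congr 1
    simp [dotProduct, latticePoint]
  have hxy : ∀ n, x n = (fun i => Complex.exp (logAbs (x n) i)) * y n := by
    intro n
    ext i
    have h1 : ‖x n i‖ ≠ 0 := norm_ne_zero_iff.2 (hx n i)
    have h2 : (‖x n i‖ : ℂ) ≠ 0 := by exact_mod_cast h1
    simp only [Pi.mul_apply, logAbs, y, ← Complex.ofReal_exp,
      Real.exp_log (norm_pos_iff.2 (hx n i))]
    field_simp
  have hzmon : ∀ a, r₀ a ≠ 0 → laurentMonomial (a.1 - b.1) z₀ = r₀ a / r₀ b := by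
    intro a ha
    have hc : ContinuousAt (laurentMonomial (a.1 - b.1)) z₀ :=
      ((contDiffOn_laurentMonomial _).contDiffAt
        (isOpen_complexTorus.mem_nhds hz₀)).continuousAt
    refine tendsto_nhds_unique (hc.tendsto.comp hzlim) ((hrlim a).congr fun n => ?_)
    rw [← hratio, hxy (φ n), Function.comp_apply, laurentMonomial_mul, laurentMonomial_mul,
      hmonreal, hmonreal, hsdot _ _ ha]
  let m : ℂ := laurentMonomial b.1 z₀ / r₀ b
  have hmon₀ : ∀ a, r₀ a ≠ 0 → laurentMonomial a.1 z₀ = m * r₀ a := by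
    intro a ha
    have h1 := hzmon a ha
    rw [laurentMonomial_sub _ _ hz₀, div_eq_iff (laurentMonomial_ne_zero _ hz₀)] at h1
    rw [h1]
    ring
  have hsub : ∀ (a : A) (u : Fin k → ℝ), latticePoint (a.1 - b.1) ⬝ᵥ u =
      latticePoint a.1 ⬝ᵥ u - latticePoint b.1 ⬝ᵥ u := fun a u => by
    rw [← sub_dotProduct]
    congr 1
    ext i
    simp [latticePoint]
  -- For one large `n` the escaping part `log |x_n| - s n` is itself a functional that cuts out the
  -- face: it is constant on the support of `r₀` and strictly smaller at all other points of `A`.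
  obtain ⟨n, hn⟩ : ∃ n, ∀ a, r₀ a = 0 →
      latticePoint (a.1 - b.1) ⬝ᵥ (logAbs (x (φ n)) - s n) < 0 := by
    have : ∀ᶠ n in atTop, ∀ a, r₀ a = 0 →
        latticePoint (a.1 - b.1) ⬝ᵥ (logAbs (x (φ n)) - s n) < 0 := by
      refine eventually_all.2 fun a => ?_
      by_cases ha : r₀ a = 0
      · have h1 : Tendsto (fun n => latticePoint (a.1 - b.1) ⬝ᵥ logAbs (x (φ n))) atTop atBot := by
          rw [← Real.tendsto_exp_comp_nhds_zero]
          simpa [hexp, ha] using (hrlim a).norm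
        have h2 : Tendsto (fun n => latticePoint (a.1 - b.1) ⬝ᵥ s n) atTop
            (𝓝 (latticePoint (a.1 - b.1) ⬝ᵥ s₀)) :=
          tendsto_finsetSum _ fun i _ => (tendsto_pi_nhds.1 hs₀ i).const_mul _
        have h3 := (h1.atBot_add h2.neg).eventually (eventually_lt_atBot 0)
        filter_upwards [h3] with n hn _
        rw [dotProduct_sub]
        simpa [sub_eq_add_neg] using hn
      · exact Eventually.of_forall fun n h => absurd h ha
    exact this.exists
  have hker : ∀ a, r₀ a ≠ 0 → latticePoint (a.1 - b.1) ⬝ᵥ (logAbs (x (φ n)) - s n) = 0 :=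
    fun a ha => by rw [dotProduct_sub, hsdot _ _ ha, sub_self]
  obtain ⟨Q, hQ, hface⟩ := exists_isNewtonFace_of_functional A (logAbs (x (φ n)) - s n) b
    (fun a => by
      rw [← sub_nonpos, ← hsub]
      by_cases ha : r₀ a = 0
      · exact (hn a ha).le
      · exact (hker a ha).le)
  have hface' : ∀ a : A, latticePoint a.1 ∈ Q ↔ r₀ a ≠ 0 := by
    intro a
    rw [hface, ← sub_eq_zero, ← hsub]
    exact ⟨fun h ha => (hn a ha).ne h, hker a⟩
  have hcoeff : ∀ a, faceCoeff A Q α a * laurentMonomial a.1 z₀ = m * (α a * r₀ a) := by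
    intro a
    by_cases ha : r₀ a = 0
    · simp [faceCoeff, Set.indicator, hface', ha]
    · simp only [faceCoeff, Set.indicator, mem_ofPred_eq, hface', ne_eq, ha, not_false_eq_true,
        if_true, hmon₀ a ha]
      ring
  refine ⟨Q, hQ, (hasTorusSingularity_iff A _).2 ⟨z₀, hz₀, ?_, ?_⟩⟩
  · simp only [laurentPoly_eq, hcoeff, ← Finset.mul_sum, hf0, mul_zero]
  · ext i
    simp only [logGrad, mul_left_comm _ (Int.cast _ : ℂ), hcoeff, Pi.zero_apply]
    rw [← mul_zero m, ← hd0 i, Finset.mul_sum]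
    exact Finset.sum_congr rfl fun a _ => by ring

/-- The lower bound of `exists_lower_bound` is locally uniform in the coefficients. -/
theorem exists_lower_bound_nhds (hA : A.Nonempty) {α : A → ℂ} (hα : α ∉ principalLocus A) :
    ∃ V : Set (A → ℂ), IsOpen V ∧ α ∈ V ∧ V ⊆ (principalLocus A)ᶜ ∧ ∃ c > 0, ∃ C > 0,
      ∀ β ∈ V, ‖β‖ ≤ C ∧ ∀ x ∈ complexTorus k,
        c * monomialSum A x ≤ ‖laurentPoly A β x‖ + ‖logGrad A β x‖ := by
  obtain ⟨c, hc, h⟩ := exists_lower_bound A hA hα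
  obtain ⟨D, hD, hgrad⟩ := exists_norm_logGrad_le A
  -- With this radius `f` and its logarithmic derivatives together change by at most `c / 2` times
  -- the monomial sum.
  have key : ∀ β ∈ Metric.ball α (c / (2 * (1 + D))), ∀ x ∈ complexTorus k,
      c / 2 * monomialSum A x ≤ ‖laurentPoly A β x‖ + ‖logGrad A β x‖ := by
    intro β hβ x hx
    have hS := monomialSum_pos A hA hx
    have h1 := h x hx
    have h2 := norm_laurentPoly_le A (α - β) x
    have h3 := hgrad (α - β) x
    rw [laurentPoly_sub] at h2
    rw [logGrad_sub] at h3
    have h4 := norm_sub_norm_le (laurentPoly A α x) (laurentPoly A β x)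
    have h5 := norm_sub_norm_le (logGrad A α x) (logGrad A β x)
    have h6 : ‖α - β‖ * (1 + D) ≤ c / 2 := by
      rw [mem_ball_iff_norm'] at hβ
      calc ‖α - β‖ * (1 + D) ≤ c / (2 * (1 + D)) * (1 + D) := by gcongr
        _ = c / 2 := by field_simp
    have h7 := mul_le_mul_of_nonneg_right h6 hS.le
    nlinarith
  refine ⟨Metric.ball α (c / (2 * (1 + D))), Metric.isOpen_ball,
    Metric.mem_ball_self (by positivity), fun β hβ hmem =>
      not_lower_bound_of_mem_principalLocus A hmem (half_pos hc) (key β hβ), c / 2, half_pos hc,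
    ‖α‖ + c / (2 * (1 + D)), by positivity, fun β hβ => ⟨?_, key β hβ⟩⟩
  rw [mem_ball_iff_norm] at hβ
  have := norm_sub_norm_le β α
  linarith

theorem isOpen_compl_principalLocus (hA : A.Nonempty) : IsOpen (principalLocus A)ᶜ := by
  rw [isOpen_iff_forall_mem_open]
  intro α hα
  obtain ⟨V, hV, hαV, hsub, -⟩ := exists_lower_bound_nhds A hA hα
  exact ⟨V, hsub, hV, hαV⟩

end LowerBound

/-! ### Constant Hermitian linear algebra in the logarithmic frame -/

section FlatForms

variable {k : ℕ} (q : QuadraticForm ℝ (Fin k → ℝ))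

/-- The Kähler metric in logarithmic coordinates. -/
def flatMetric (ξ η : Fin k → ℂ) : ℝ :=
  polarForm q (rePart ξ) (rePart η) + polarForm q (imPart ξ) (imPart η)

/-- The Kähler form in logarithmic coordinates. -/
def flatForm (ξ η : Fin k → ℂ) : ℝ :=
  polarForm q (rePart ξ) (imPart η) - polarForm q (imPart ξ) (rePart η)

theorem rePart_smul (c : ℂ) (ξ : Fin k → ℂ) :
    rePart (c • ξ) = c.re • rePart ξ - c.im • imPart ξ := by
  ext i; simp

theorem imPart_smul (c : ℂ) (ξ : Fin k → ℂ) :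
    imPart (c • ξ) = c.re • imPart ξ + c.im • rePart ξ := by
  ext i; simp

theorem flatMetric_smul (c : ℂ) (ξ η : Fin k → ℂ) :
    flatMetric q ξ (c • η) = c.re * flatMetric q ξ η - c.im * flatForm q ξ η := by
  simp only [flatMetric, flatForm, rePart_smul, imPart_smul, map_sub, map_add, map_smul,
    smul_eq_mul]
  ring

theorem flatForm_smul (c : ℂ) (ξ η : Fin k → ℂ) :
    flatForm q ξ (c • η) = c.re * flatForm q ξ η + c.im * flatMetric q ξ η := by
  simp only [flatMetric, flatForm, rePart_smul, imPart_smul, map_sub, map_add, map_smul,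
    smul_eq_mul]
  ring

theorem flatMetric_sub (ξ η ζ : Fin k → ℂ) :
    flatMetric q ξ (η - ζ) = flatMetric q ξ η - flatMetric q ξ ζ := by
  simp only [flatMetric, map_sub]; ring

theorem flatForm_sub (ξ η ζ : Fin k → ℂ) :
    flatForm q ξ (η - ζ) = flatForm q ξ η - flatForm q ξ ζ := by
  simp only [flatForm, map_sub]; ring

theorem flatForm_swap (ξ η : Fin k → ℂ) : flatForm q ξ η = -flatForm q η ξ := by
  simp only [flatForm, polarForm_comm q (rePart ξ), polarForm_comm q (imPart ξ)]; ring

theorem flatForm_self (ξ : Fin k → ℂ) : flatForm q ξ ξ = 0 := by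
  have := flatForm_swap q ξ ξ; linarith

theorem norm_sq_le_rePart_imPart (ξ : Fin k → ℂ) :
    ‖ξ‖ ^ 2 ≤ ‖rePart ξ‖ ^ 2 + ‖imPart ξ‖ ^ 2 := by
  have h : ‖ξ‖ ≤ √(‖rePart ξ‖ ^ 2 + ‖imPart ξ‖ ^ 2) := by
    refine (pi_norm_le_iff_of_nonneg (Real.sqrt_nonneg _)).2 fun i => ?_
    refine Real.le_sqrt_of_sq_le ?_
    rw [← Complex.normSq_eq_norm_sq, Complex.normSq_apply, ← sq, ← sq]
    have h1 := norm_le_pi_norm (rePart ξ) i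
    have h2 := norm_le_pi_norm (imPart ξ) i
    rw [rePart_apply, Real.norm_eq_abs] at h1
    rw [imPart_apply, Real.norm_eq_abs] at h2
    exact add_le_add (sq_le_sq.2 (by rwa [abs_norm])) (sq_le_sq.2 (by rwa [abs_norm]))
  calc ‖ξ‖ ^ 2 ≤ √(‖rePart ξ‖ ^ 2 + ‖imPart ξ‖ ^ 2) ^ 2 := by gcongr
    _ = _ := Real.sq_sqrt (by positivity)

theorem exists_norm_flat_le : ∃ C > 0, ∀ ξ η : Fin k → ℂ,
    |flatMetric q ξ η| + |flatForm q ξ η| ≤ C * ‖ξ‖ * ‖η‖ := by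
  refine ⟨4 * ‖polarForm q‖ + 1, by positivity, fun ξ η => ?_⟩
  have hre : ∀ ζ : Fin k → ℂ, ‖rePart ζ‖ ≤ ‖ζ‖ := fun ζ =>
    (pi_norm_le_iff_of_nonneg (norm_nonneg _)).2 fun i =>
      (Complex.abs_re_le_norm _).trans (norm_le_pi_norm ζ i)
  have him : ∀ ζ : Fin k → ℂ, ‖imPart ζ‖ ≤ ‖ζ‖ := fun ζ =>
    (pi_norm_le_iff_of_nonneg (norm_nonneg _)).2 fun i =>
      (Complex.abs_im_le_norm _).trans (norm_le_pi_norm ζ i)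
  have key : ∀ u v : Fin k → ℝ, ‖u‖ ≤ ‖ξ‖ → ‖v‖ ≤ ‖η‖ →
      |polarForm q u v| ≤ ‖polarForm q‖ * ‖ξ‖ * ‖η‖ := fun u v hu hv =>
    ((polarForm q).le_opNorm₂ u v).trans (by gcongr)
  have h1 := key _ _ (hre ξ) (hre η)
  have h2 := key _ _ (him ξ) (him η)
  have h3 := key _ _ (hre ξ) (him η)
  have h4 := key _ _ (him ξ) (hre η)
  have h5 := abs_add_le (polarForm q (rePart ξ) (rePart η)) (polarForm q (imPart ξ) (imPart η))
  have h6 := abs_sub (polarForm q (rePart ξ) (imPart η)) (polarForm q (imPart ξ) (rePart η))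
  have h7 : 0 ≤ ‖ξ‖ * ‖η‖ := by positivity
  simp only [flatMetric, flatForm]
  nlinarith

variable {q}

theorem exists_pos_mul_sq_le_flatMetric (hq : q.PosDef) :
    ∃ c > 0, ∀ ξ, c * ‖ξ‖ ^ 2 ≤ flatMetric q ξ ξ := by
  obtain ⟨c, hc, h⟩ := exists_pos_mul_sq_le hq
  refine ⟨2 * c, by positivity, fun ξ => ?_⟩
  have h1 := h (rePart ξ)
  have h2 := h (imPart ξ)
  have h3 := mul_le_mul_of_nonneg_left (norm_sq_le_rePart_imPart ξ) hc.le
  rw [flatMetric, polarForm_self, polarForm_self]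
  linarith

theorem flatMetric_pos (hq : q.PosDef) {ξ : Fin k → ℂ} (hξ : ξ ≠ 0) : 0 < flatMetric q ξ ξ := by
  obtain ⟨c, hc, h⟩ := exists_pos_mul_sq_le_flatMetric hq
  exact (mul_pos hc (pow_pos (norm_pos_iff.2 hξ) 2)).trans_le (h ξ)

/-- The conjugate linear map that turns a complex linear form into its Hermitian dual vector. -/
def hermDual (hq : q.PosDef) : (Fin k → ℂ) →L[ℝ] (Fin k → ℂ) :=
  ContinuousLinearMap.pi fun i =>
    Complex.ofRealCLM.comp ((ContinuousLinearMap.proj i).comp ((exists_sharp hq).choose.comp rePart)) -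
    (Complex.I • Complex.ofRealCLM).comp
      ((ContinuousLinearMap.proj i).comp ((exists_sharp hq).choose.comp imPart))

theorem rePart_hermDual (hq : q.PosDef) (d : Fin k → ℂ) :
    rePart (hermDual hq d) = (exists_sharp hq).choose (rePart d) := by
  ext i; simp [hermDual]

theorem imPart_hermDual (hq : q.PosDef) (d : Fin k → ℂ) :
    imPart (hermDual hq d) = -(exists_sharp hq).choose (imPart d) := by
  ext i; simp [hermDual]

theorem flatMetric_hermDual (hq : q.PosDef) (ξ d : Fin k → ℂ) :
    flatMetric q ξ (hermDual hq d) = (d ⬝ᵥ ξ).re := by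
  rw [flatMetric, rePart_hermDual, imPart_hermDual, map_neg, (exists_sharp hq).choose_spec,
    (exists_sharp hq).choose_spec]
  simp [dotProduct, sub_eq_add_neg, Finset.sum_add_distrib]

theorem flatForm_hermDual (hq : q.PosDef) (ξ d : Fin k → ℂ) :
    flatForm q ξ (hermDual hq d) = -(d ⬝ᵥ ξ).im := by
  rw [flatForm, rePart_hermDual, imPart_hermDual, map_neg, (exists_sharp hq).choose_spec,
    (exists_sharp hq).choose_spec]
  simp [dotProduct, Finset.sum_add_distrib]
  ring

/-- The squared length of the Hermitian dual vector of a linear form. -/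
def dualNormSq (hq : q.PosDef) (d : Fin k → ℂ) : ℝ :=
  flatMetric q (hermDual hq d) (hermDual hq d)

theorem dotProduct_hermDual (hq : q.PosDef) (d : Fin k → ℂ) :
    d ⬝ᵥ hermDual hq d = (dualNormSq hq d : ℂ) := by
  apply Complex.ext
  · rw [← flatMetric_hermDual hq, Complex.ofReal_re, dualNormSq]
  · rw [Complex.ofReal_im, ← neg_eq_zero, ← flatForm_hermDual hq, flatForm_self]

/-- Pairing the dual vector with the `i`-th basis vector recovers `d i`, so `‖d‖` is at most a
constant times the norm of the dual vector. -/
theorem exists_pos_mul_sq_le_dualNormSq (hq : q.PosDef) :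
    ∃ c > 0, ∀ d, c * ‖d‖ ^ 2 ≤ dualNormSq hq d := by
  obtain ⟨c, hc, h⟩ := exists_pos_mul_sq_le_flatMetric hq
  obtain ⟨C, hC, hb⟩ := exists_norm_flat_le q
  refine ⟨c / C ^ 2, by positivity, fun d => ?_⟩
  have h1 : ‖d‖ ≤ C * ‖hermDual hq d‖ := by
    refine (pi_norm_le_iff_of_nonneg (by positivity)).2 fun i => ?_
    have h2 := hb (Pi.single i 1) (hermDual hq d)
    rw [flatMetric_hermDual, flatForm_hermDual, abs_neg, dotProduct_single, mul_one,
      Pi.norm_single, norm_one, mul_one] at h2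
    exact (Complex.norm_le_abs_re_add_abs_im _).trans h2
  have h3 : ‖d‖ ^ 2 ≤ C ^ 2 * ‖hermDual hq d‖ ^ 2 := by
    rw [← mul_pow]; gcongr
  calc c / C ^ 2 * ‖d‖ ^ 2 ≤ c / C ^ 2 * (C ^ 2 * ‖hermDual hq d‖ ^ 2) := by gcongr
    _ = c * ‖hermDual hq d‖ ^ 2 := by field_simp
    _ ≤ _ := h _

theorem contDiff_dualNormSq (hq : q.PosDef) : ContDiff ℝ ∞ (dualNormSq hq) := by
  have hre : ContDiff ℝ ∞ fun d => rePart (hermDual hq d) :=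
    rePart.contDiff.comp (hermDual hq).contDiff
  have him : ContDiff ℝ ∞ fun d => imPart (hermDual hq d) :=
    imPart.contDiff.comp (hermDual hq).contDiff
  exact (((polarForm q).contDiff.comp hre).clm_apply hre).add
    (((polarForm q).contDiff.comp him).clm_apply him)

end FlatForms

/-! ### The projected gradient and its normal component -/

section LiouvilleField

variable {k : ℕ} (A : Finset (Fin k → ℤ)) {q : QuadraticForm ℝ (Fin k → ℝ)}

/-- The gradient of the toric potential in logarithmic coordinates. -/
def logRadial (x : Fin k → ℂ) : Fin k → ℂ := fun i => (Real.log ‖x i‖ : ℂ)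

@[simp] theorem rePart_logRadial (x : Fin k → ℂ) : rePart (logRadial x) = logAbs x := rfl

@[simp] theorem imPart_logRadial (x : Fin k → ℂ) : imPart (logRadial x) = 0 := rfl

theorem norm_logRadial (x : Fin k → ℂ) : ‖logRadial x‖ = ‖logAbs x‖ := by
  have h : ∀ i, ‖logRadial x i‖ = ‖logAbs x i‖ := fun i => Complex.norm_real _
  refine le_antisymm ?_ ?_ <;> refine (pi_norm_le_iff_of_nonneg (norm_nonneg _)).2 fun i => ?_
  · rw [h]; exact norm_le_pi_norm _ i
  · rw [← h]; exact norm_le_pi_norm _ i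

/-- On the hypersurface, the component of the gradient along the logarithmic radial vector is
controlled by the monomials alone. -/
theorem norm_logGrad_dotProduct_logRadial_le (α : A → ℂ) {x : Fin k → ℂ}
    (hx : x ∈ complexTorus k) (hf : laurentPoly A α x = 0) :
    ‖logGrad A α x ⬝ᵥ logRadial x‖ ≤ A.card * ‖α‖ * monomialSum A x := by
  rcases A.eq_empty_or_nonempty with rfl | hA
  · have : logGrad ∅ α x = 0 := by ext i; simp [logGrad]
    simp [this]
  have : Nonempty A := hA.to_subtype
  obtain ⟨b, -, hb⟩ := Finset.exists_max_image (Finset.univ : Finset A)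
    (fun a => latticePoint a.1 ⬝ᵥ logAbs x) Finset.univ_nonempty
  -- The subtracted term is `⟨b, log |x|⟩ f_α(x)`, zero on the hypersurface; `b` maximises the
  -- exponent.
  have h1 : logGrad A α x ⬝ᵥ logRadial x = ∑ a : A, α a *
      (((latticePoint a.1 ⬝ᵥ logAbs x - latticePoint b.1 ⬝ᵥ logAbs x : ℝ) : ℂ) *
        laurentMonomial a.1 x) := by
    have h2 : logGrad A α x ⬝ᵥ logRadial x = ∑ a : A, α a *
        ((latticePoint a.1 ⬝ᵥ logAbs x : ℝ) * laurentMonomial a.1 x) := by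
      simp only [dotProduct, logGrad, latticePoint, logRadial, logAbs, Complex.ofReal_sum,
        Finset.sum_mul, Finset.mul_sum]
      rw [Finset.sum_comm]
      refine Finset.sum_congr rfl fun a _ => Finset.sum_congr rfl fun i _ => ?_
      push_cast
      ring
    have h3 : ∑ a : A, α a * ((latticePoint b.1 ⬝ᵥ logAbs x : ℝ) * laurentMonomial a.1 x) = 0 := by
      simp only [mul_left_comm (α _)]
      rw [← Finset.mul_sum, ← laurentPoly_eq, hf, mul_zero]
    rw [h2, ← sub_zero (∑ a : A, _), ← h3, ← Finset.sum_sub_distrib]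
    refine Finset.sum_congr rfl fun a _ => ?_
    push_cast
    ring
  rw [h1]
  have h4 : ∀ a : A, ‖α a * (((latticePoint a.1 ⬝ᵥ logAbs x - latticePoint b.1 ⬝ᵥ logAbs x : ℝ) : ℂ)
      * laurentMonomial a.1 x)‖ ≤ ‖α‖ * monomialSum A x := by
    intro a
    rw [norm_mul]
    refine mul_le_mul (norm_le_pi_norm α a) ?_ (norm_nonneg _) (norm_nonneg _)
    refine le_trans ?_ (norm_laurentMonomial_le_monomialSum A b x)
    have hle := sub_nonneg.2 (hb a (Finset.mem_univ _))
    rw [norm_mul, norm_laurentMonomial _ hx, norm_laurentMonomial _ hx, Complex.norm_real,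
      ← norm_neg, neg_sub, Real.norm_of_nonneg hle]
    set s := latticePoint b.1 ⬝ᵥ logAbs x - latticePoint a.1 ⬝ᵥ logAbs x with hs
    have hbs : latticePoint b.1 ⬝ᵥ logAbs x = s + latticePoint a.1 ⬝ᵥ logAbs x := by
      rw [hs, sub_add_cancel]
    rw [hbs, Real.exp_add]
    exact mul_le_mul_of_nonneg_right (by linarith [Real.add_one_le_exp s]) (Real.exp_pos _).le
  refine (norm_sum_le_of_le _ fun a _ => h4 a).trans (le_of_eq ?_)
  simp [mul_assoc]

/-- The positive function that agrees with the squared length of the gradient on the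
hypersurface. -/
def gradDenom (hq : q.PosDef) (α : A → ℂ) (x : Fin k → ℂ) : ℝ :=
  dualNormSq hq (logGrad A α x) + ‖laurentPoly A α x‖ ^ 2

/-- The projection of the gradient of the toric potential to the hypersurface, in logarithmic
coordinates, extended smoothly to the torus. -/
def projectedGradient (hq : q.PosDef) (α : A → ℂ) (x : Fin k → ℂ) : Fin k → ℂ :=
  logRadial x - (logGrad A α x ⬝ᵥ logRadial x / (gradDenom A hq α x : ℂ)) •
    hermDual hq (logGrad A α x)

theorem dualNormSq_nonneg (hq : q.PosDef) (d : Fin k → ℂ) : 0 ≤ dualNormSq hq d := by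
  obtain ⟨c, hc, h⟩ := exists_pos_mul_sq_le_dualNormSq hq
  exact le_trans (by positivity) (h d)

theorem dualNormSq_pos (hq : q.PosDef) {d : Fin k → ℂ} (hd : d ≠ 0) : 0 < dualNormSq hq d := by
  obtain ⟨c, hc, h⟩ := exists_pos_mul_sq_le_dualNormSq hq
  exact (mul_pos hc (pow_pos (norm_pos_iff.2 hd) 2)).trans_le (h d)

/-- Off the hypersurface the logarithmic gradient may vanish; the added `|f|²` keeps the denominator
positive there, because `f` and its gradient have no common zero. -/
theorem gradDenom_pos (hA : A.Nonempty) (hq : q.PosDef) {α : A → ℂ} (hα : α ∉ principalLocus A)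
    {x : Fin k → ℂ} (hx : x ∈ complexTorus k) : 0 < gradDenom A hq α x := by
  obtain ⟨c, hc, h⟩ := exists_lower_bound A hA hα
  have h1 := (mul_pos hc (monomialSum_pos A hA hx)).trans_le (h x hx)
  rw [gradDenom]
  by_cases hd : logGrad A α x = 0
  · rw [hd, norm_zero, add_zero] at h1
    exact add_pos_of_nonneg_of_pos (dualNormSq_nonneg hq _) (pow_pos h1 2)
  · exact add_pos_of_pos_of_nonneg (dualNormSq_pos hq hd) (sq_nonneg _)

/-- Written as a multiple of `f`, the derivative of `f` along the extended field turns into a linear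
differential equation for `f` on each flow line, so the zero set is invariant. -/
theorem logGrad_dotProduct_projectedGradient (hA : A.Nonempty) (hq : q.PosDef) {α : A → ℂ}
    (hα : α ∉ principalLocus A) {x : Fin k → ℂ} (hx : x ∈ complexTorus k) :
    logGrad A α x ⬝ᵥ projectedGradient A hq α x =
      (logGrad A α x ⬝ᵥ logRadial x * star (laurentPoly A α x) / (gradDenom A hq α x : ℂ)) *
        laurentPoly A α x := by
  have h0 : (gradDenom A hq α x : ℂ) ≠ 0 :=
    Complex.ofReal_ne_zero.2 (gradDenom_pos A hA hq hα hx).ne'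
  have h1 : (dualNormSq hq (logGrad A α x) : ℂ) = gradDenom A hq α x -
      star (laurentPoly A α x) * laurentPoly A α x := by
    rw [gradDenom, Complex.star_def, Complex.conj_mul']
    push_cast
    ring
  rw [projectedGradient, dotProduct_sub, dotProduct_smul, dotProduct_hermDual, h1, smul_eq_mul]
  field_simp
  ring

theorem logGrad_dotProduct_projectedGradient_eq_zero (hA : A.Nonempty) (hq : q.PosDef) {α : A → ℂ}
    (hα : α ∉ principalLocus A) {x : Fin k → ℂ} (hx : x ∈ complexTorus k)
    (hf : laurentPoly A α x = 0) : logGrad A α x ⬝ᵥ projectedGradient A hq α x = 0 := by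
  rw [logGrad_dotProduct_projectedGradient A hA hq hα hx, hf, mul_zero]

/-- The correction along the dual vector pairs to zero with tangent vectors, so the projected field
satisfies `i_Z dθ = θ` along the hypersurface. -/
theorem flatForm_projectedGradient (hq : q.PosDef) (α : A → ℂ) (x : Fin k → ℂ)
    {η : Fin k → ℂ} (hη : logGrad A α x ⬝ᵥ η = 0) :
    flatForm q (projectedGradient A hq α x) η = polarForm q (logAbs x) (imPart η) := by
  rw [flatForm_swap, projectedGradient, flatForm_sub, flatForm_smul, flatMetric_hermDual,
    flatForm_hermDual, hη, flatForm_swap]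
  simp [flatForm]

theorem flatMetric_logRadial_projectedGradient (hq : q.PosDef) (α : A → ℂ) (x : Fin k → ℂ) :
    polarForm q (logAbs x) (rePart (projectedGradient A hq α x)) =
      2 * toricPotential q x -
        ‖logGrad A α x ⬝ᵥ logRadial x‖ ^ 2 / gradDenom A hq α x := by
  have h1 : polarForm q (logAbs x) (rePart (projectedGradient A hq α x)) =
      flatMetric q (logRadial x) (projectedGradient A hq α x) := by simp [flatMetric]
  have h2 : flatMetric q (logRadial x) (logRadial x) = 2 * toricPotential q x := by
    simp [flatMetric, polarForm_self, toricPotential_eq]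
  rw [h1, projectedGradient, flatMetric_sub, flatMetric_smul, flatMetric_hermDual,
    flatForm_hermDual, h2, ← Complex.normSq_eq_norm_sq, Complex.normSq_apply,
    Complex.div_ofReal_re, Complex.div_ofReal_im]
  ring

/-- The correction term is quadratic in `d` above and at least quadratic below, so the size of `d`
cancels and only the linear factor `log |x|` remains. -/
theorem exists_norm_projectedGradient_le (hq : q.PosDef) (α : A → ℂ) : ∃ C ≥ 0, ∀ x,
    ‖projectedGradient A hq α x‖ ≤ C * ‖logAbs x‖ := by
  obtain ⟨c, hc, h⟩ := exists_pos_mul_sq_le_dualNormSq hq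
  refine ⟨1 + k * ‖hermDual hq‖ / c, by positivity, fun x => ?_⟩
  set d := logGrad A α x with hd
  have h1 : ‖(d ⬝ᵥ logRadial x / (gradDenom A hq α x : ℂ)) • hermDual hq d‖ ≤
      k * ‖hermDual hq‖ / c * ‖logAbs x‖ := by
    by_cases hd0 : d = 0
    · rw [hd0]; simp; positivity
    have hn : 0 < ‖d‖ := norm_pos_iff.2 hd0
    have hden : c * ‖d‖ ^ 2 ≤ gradDenom A hq α x :=
      (h d).trans (le_add_of_nonneg_right (sq_nonneg _))
    have hden0 : 0 < gradDenom A hq α x := (by positivity : 0 < c * ‖d‖ ^ 2).trans_le hden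
    have hdot : ‖d ⬝ᵥ logRadial x‖ ≤ k * (‖d‖ * ‖logAbs x‖) := by
      refine (norm_sum_le_of_le _ (n := fun _ => ‖d‖ * ‖logAbs x‖) fun i _ => ?_).trans (by simp)
      rw [norm_mul, ← norm_logRadial]
      exact mul_le_mul (norm_le_pi_norm d i) (norm_le_pi_norm _ i) (norm_nonneg _) (norm_nonneg _)
    rw [norm_smul, norm_div, Complex.norm_real, Real.norm_of_nonneg hden0.le, div_mul_eq_mul_div,
      div_le_iff₀ hden0]
    calc ‖d ⬝ᵥ logRadial x‖ * ‖hermDual hq d‖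
        ≤ k * (‖d‖ * ‖logAbs x‖) * (‖hermDual hq‖ * ‖d‖) := by
          gcongr
          exact (hermDual hq).le_opNorm d
      _ = k * ‖hermDual hq‖ / c * ‖logAbs x‖ * (c * ‖d‖ ^ 2) := by field_simp
      _ ≤ _ := by gcongr
  rw [projectedGradient]
  refine (norm_sub_le _ _).trans ?_
  rw [norm_logRadial]
  linarith

theorem contDiffOn_projectedGradient (hA : A.Nonempty) (hq : q.PosDef) {α : A → ℂ}
    (hα : α ∉ principalLocus A) : ContDiffOn ℝ ∞ (projectedGradient A hq α) (complexTorus k) := by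
  have hpoly : ContDiffOn ℝ ∞ (laurentPoly A α) (complexTorus k) :=
    (contDiffOn_laurentPoly A).comp (contDiff_prodMk_right α).contDiffOn
      fun x hx => ⟨mem_univ _, hx⟩
  have hd := contDiffOn_logGrad A α
  have hu : ContDiffOn ℝ ∞ (logRadial (k := k)) (complexTorus k) :=
    contDiffOn_pi.2 fun i => Complex.ofRealCLM.contDiff.comp_contDiffOn
      (contDiffOn_pi.1 contDiffOn_logAbs i)
  have hden : ContDiffOn ℝ ∞ (gradDenom A hq α) (complexTorus k) :=
    ((contDiff_dualNormSq hq).comp_contDiffOn hd).add (hpoly.norm_sq ℝ)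
  have hdot : ContDiffOn ℝ ∞ (fun x => logGrad A α x ⬝ᵥ logRadial x) (complexTorus k) :=
    ContDiffOn.sum fun i _ => (contDiffOn_pi.1 hd i).mul (contDiffOn_pi.1 hu i)
  have hquot : ContDiffOn ℝ ∞ (fun x => logGrad A α x ⬝ᵥ logRadial x / (gradDenom A hq α x : ℂ))
      (complexTorus k) := by
    have h := hdot.mul (Complex.ofRealCLM.contDiff.comp_contDiffOn
      (hden.inv fun x hx => (gradDenom_pos A hA hq hα hx).ne'))
    refine h.congr fun x _ => ?_
    simp [div_eq_mul_inv]
  exact hu.sub (hquot.smul ((hermDual hq).contDiff.comp_contDiffOn hd))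

end LiouvilleField

/-! ### Completeness of the Liouville flow and growth of the potential -/

section HypersurfaceFlow

variable {k : ℕ} (A : Finset (Fin k → ℤ)) {q : QuadraticForm ℝ (Fin k → ℝ)}

/-- The Liouville vector field of the hypersurface. -/
def hypersurfaceLiouvilleField (hq : q.PosDef) (α : A → ℂ) (x : Fin k → ℂ) : Fin k → ℂ :=
  x * projectedGradient A hq α x

theorem mul_div_cancel_of_mem_complexTorus {x : Fin k → ℂ} (hx : x ∈ complexTorus k)
    (v : Fin k → ℂ) : x * v / x = v := by
  ext i
  exact mul_div_cancel_left₀ (v i) (hx i)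

theorem logAbs_exp (w : Fin k → ℂ) : logAbs (fun i => Complex.exp (w i)) = rePart w := by
  ext i; simp [logAbs, Complex.norm_exp]

theorem exists_isFlowLine (hA : A.Nonempty) (hq : q.PosDef) {α : A → ℂ}
    {x : Fin k → ℂ} (hx : x ∈ fibreAt (hypersurfaceFamily A) α) :
    ∃ γ, IsFlowLine (fibreAt (hypersurfaceFamily A) α) (hypersurfaceLiouvilleField A hq α) γ ∧
      γ 0 = x := by
  obtain ⟨hα, hxt, hf⟩ : α ∉ principalLocus A ∧ x ∈ complexTorus k ∧ laurentPoly A α x = 0 := hx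
  -- Pull the field back by the exponential map: the torus becomes a vector space, on which the
  -- field is smooth and of linear growth.
  let ex : (Fin k → ℂ) → Fin k → ℂ := fun w i => Complex.exp (w i)
  have hex : ContDiff ℝ ∞ ex := contDiff_pi.2 fun i =>
    (Complex.contDiff_exp (𝕜 := ℝ)).comp (contDiff_apply ℝ ℂ i)
  let G : (Fin k → ℂ) → Fin k → ℂ := fun w => projectedGradient A hq α (ex w)
  have hG : ContDiff ℝ ∞ G := by
    rw [← contDiffOn_univ]
    exact (contDiffOn_projectedGradient A hA hq hα).comp hex.contDiffOn
      fun w _ => exp_mem_complexTorus w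
  obtain ⟨C, hC, hbound⟩ := exists_norm_projectedGradient_le A hq α
  have hgrowth : ∀ w, ‖G w‖ ≤ C * ‖w‖ := fun w => by
    refine (hbound _).trans (mul_le_mul_of_nonneg_left ?_ hC)
    rw [logAbs_exp]
    exact (pi_norm_le_iff_of_nonneg (norm_nonneg _)).2 fun i =>
      (Complex.abs_re_le_norm _).trans (norm_le_pi_norm w i)
  obtain ⟨γ, h0, hγ⟩ := exists_isIntegralCurve_of_linear_growth (hG.of_le (by norm_num)) hC
    hgrowth (fun i => Complex.log (x i))
  have hγt : ∀ t, ex (γ t) ∈ complexTorus k := fun t => exp_mem_complexTorus _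
  have hγc : Continuous γ := continuous_iff_continuousAt.2 fun t => (hγ t).continuousAt
  have hexγ : ∀ t, HasDerivAt (fun t => ex (γ t))
      (hypersurfaceLiouvilleField A hq α (ex (γ t))) t := by
    intro t
    rw [hasDerivAt_pi]
    intro i
    exact ((hasDerivAt_pi.1 (hγ t)) i).cexp
  have hx0 : ex (γ 0) = x := by
    ext i; simp [ex, h0, Complex.exp_log (hxt i)]
  have hfγ : ∀ t, laurentPoly A α (ex (γ t)) = 0 := by
    refine eq_zero_of_hasDerivAt_mul
      (κ := fun t => logGrad A α (ex (γ t)) ⬝ᵥ logRadial (ex (γ t)) *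
        star (laurentPoly A α (ex (γ t))) / (gradDenom A hq α (ex (γ t)) : ℂ)) ?_ (fun t => ?_)
      (by rw [hx0, hf])
    · have hcont : ∀ {F : Type} [TopologicalSpace F] {φ : (Fin k → ℂ) → F},
          ContinuousOn φ (complexTorus k) → Continuous fun t => φ (ex (γ t)) := fun hφ =>
        hφ.comp_continuous (hex.continuous.comp hγc) hγt
      have hd : Continuous fun t => logGrad A α (ex (γ t)) :=
        hcont (contDiffOn_logGrad A α).continuousOn
      have hu : Continuous fun t => logRadial (ex (γ t)) :=
        continuous_pi fun i => Complex.continuous_ofReal.comp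
          (continuous_pi_iff.1 (hcont contDiffOn_logAbs.continuousOn) i)
      have hp : Continuous fun t => laurentPoly A α (ex (γ t)) :=
        hcont fun y hy => (hasFDerivAt_laurentPoly A α hy).continuousAt.continuousWithinAt
      have hden : Continuous fun t => gradDenom A hq α (ex (γ t)) :=
        ((contDiff_dualNormSq hq).continuous.comp hd).add (hp.norm.pow 2)
      exact ((hd.dotProduct hu).mul hp.star).div (Complex.continuous_ofReal.comp hden)
        fun t => Complex.ofReal_ne_zero.2 (gradDenom_pos A hA hq hα (hγt t)).ne'
    · have h1 := ((hasFDerivAt_laurentPoly A α (hγt t)).restrictScalars ℝ).comp_hasDerivAt t (hexγ t)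
      refine h1.congr_deriv ?_
      rw [← logGrad_dotProduct_projectedGradient A hA hq hα (hγt t),
        ContinuousLinearMap.coe_restrictScalars', ← (hasFDerivAt_laurentPoly A α (hγt t)).fderiv,
        fderiv_laurentPoly A α (hγt t), hypersurfaceLiouvilleField,
        mul_div_cancel_of_mem_complexTorus (hγt t)]
      rfl
  exact ⟨fun t => ex (γ t), ⟨fun t => ⟨hα, hγt t, hfγ t⟩, hexγ⟩, hx0⟩

/-- Locally uniformly in the coefficients, the component of the gradient of the toric potential
normal to the hypersurface is bounded. -/
theorem exists_normal_component_le (hA : A.Nonempty) (hq : q.PosDef) {α : A → ℂ}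
    (hα : α ∉ principalLocus A) :
    ∃ V : Set (A → ℂ), IsOpen V ∧ α ∈ V ∧ V ⊆ (principalLocus A)ᶜ ∧ ∃ D ≥ 0,
      ∀ β ∈ V, ∀ x ∈ complexTorus k, laurentPoly A β x = 0 → logGrad A β x ≠ 0 ∧
        ‖logGrad A β x ⬝ᵥ logRadial x‖ ^ 2 ≤ D * dualNormSq hq (logGrad A β x) := by
  obtain ⟨V, hV, hαV, hsub, c, hc, C, hC, h⟩ := exists_lower_bound_nhds A hA hα
  obtain ⟨κ, hκ, hdual⟩ := exists_pos_mul_sq_le_dualNormSq hq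
  -- The monomial sum cancels between the upper bound `|A| C S` for the numerator and the lower
  -- bound `κ (c S)²` for the squared dual norm.
  refine ⟨V, hV, hαV, hsub, (A.card * C) ^ 2 / (κ * c ^ 2), by positivity,
    fun β hβ x hx hf => ?_⟩
  obtain ⟨hβC, hlow⟩ := h β hβ
  have hS := monomialSum_pos A hA hx
  have h1 := hlow x hx
  rw [hf, norm_zero, zero_add] at h1
  have h2 := norm_logGrad_dotProduct_logRadial_le A β hx hf
  refine ⟨fun h0 => ?_, ?_⟩
  · rw [h0, norm_zero] at h1
    exact absurd h1 (not_le.2 (mul_pos hc hS))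
  calc ‖logGrad A β x ⬝ᵥ logRadial x‖ ^ 2 ≤ (A.card * C * monomialSum A x) ^ 2 := by
        gcongr
        exact h2.trans (by gcongr)
    _ = (A.card * C) ^ 2 / (κ * c ^ 2) * (κ * (c * monomialSum A x) ^ 2) := by field_simp
    _ ≤ (A.card * C) ^ 2 / (κ * c ^ 2) * (κ * ‖logGrad A β x‖ ^ 2) := by gcongr
    _ ≤ _ := by gcongr; exact hdual _

theorem fderiv_toricPotential_liouvilleField (hq : q.PosDef) (α : A → ℂ) {x : Fin k → ℂ}
    (hx : x ∈ complexTorus k) (hf : laurentPoly A α x = 0) :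
    fderiv ℝ (toricPotential q) x (hypersurfaceLiouvilleField A hq α x) =
      2 * toricPotential q x -
        ‖logGrad A α x ⬝ᵥ logRadial x‖ ^ 2 / dualNormSq hq (logGrad A α x) := by
  rw [fderiv_toricPotential q hx, hypersurfaceLiouvilleField,
    mul_div_cancel_of_mem_complexTorus hx, flatMetric_logRadial_projectedGradient, gradDenom, hf]
  simp

theorem fderiv_toricPotential_liouvilleField_ge (hq : q.PosDef) {α : A → ℂ} {D : ℝ}
    {x : Fin k → ℂ} (hx : x ∈ complexTorus k) (hf : laurentPoly A α x = 0)
    (hd : logGrad A α x ≠ 0)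
    (hD : ‖logGrad A α x ⬝ᵥ logRadial x‖ ^ 2 ≤ D * dualNormSq hq (logGrad A α x)) :
    2 * toricPotential q x - D ≤
      fderiv ℝ (toricPotential q) x (hypersurfaceLiouvilleField A hq α x) := by
  rw [fderiv_toricPotential_liouvilleField A hq α hx hf]
  have := (div_le_iff₀ (dualNormSq_pos hq hd)).2 hD
  linarith

/-- If the potential increases at a definite rate along the flow outside the sublevel set
`{ψ ≤ R}`, then this sublevel set generates the hypersurface. -/
theorem exists_isFlowLine_of_sublevel (hA : A.Nonempty) (hq : q.PosDef) {α : A → ℂ} {R : ℝ}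
    (hR : ∀ y ∈ fibreAt (hypersurfaceFamily A) α, R ≤ toricPotential q y →
      1 ≤ fderiv ℝ (toricPotential q) y (hypersurfaceLiouvilleField A hq α y))
    {x : Fin k → ℂ} (hx : x ∈ fibreAt (hypersurfaceFamily A) α) :
    ∃ γ, IsFlowLine (fibreAt (hypersurfaceFamily A) α) (hypersurfaceLiouvilleField A hq α) γ ∧
      toricPotential q (γ 0) ≤ R ∧ ∃ t, 0 ≤ t ∧ γ t = x := by
  obtain ⟨γ, ⟨hγS, hγ⟩, h0⟩ := exists_isFlowLine A hA hq hx
  obtain ⟨s, hs, hsR⟩ : ∃ s ≥ 0, toricPotential q (γ (-s)) ≤ R := by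
    by_contra! hcon
    have hderiv : ∀ t, HasDerivAt (fun t => toricPotential q (γ t))
        (fderiv ℝ (toricPotential q) (γ t) (hypersurfaceLiouvilleField A hq α (γ t))) t := by
      intro t
      have hd : DifferentiableAt ℝ (toricPotential q) (γ t) :=
        ((contDiffOn_toricPotential q).contDiffAt
          (isOpen_complexTorus.mem_nhds (hγS t).2.1)).differentiableAt (by simp)
      exact hd.hasFDerivAt.comp_hasDerivAt t (hγ t)
    have hdiff : Differentiable ℝ fun t => toricPotential q (γ t) := fun t =>
      (hderiv t).differentiableAt
    -- Flowing back for time `T` at rate at least one would bring the potential down to `R`.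
    set T := toricPotential q x - R with hT
    have hT0 : 0 ≤ T := by
      have := hcon 0 le_rfl
      rw [neg_zero, h0] at this
      linarith
    have hmv := (convex_Icc (-T) 0).mul_sub_le_image_sub_of_le_deriv (C := 1)
      hdiff.continuous.continuousOn hdiff.differentiableOn (fun t ht => by
        rw [(hderiv t).deriv]
        rw [interior_Icc] at ht
        have := hcon (-t) (by linarith [ht.2])
        rw [neg_neg] at this
        exact hR _ (hγS t) this.le) (-T) (left_mem_Icc.2 (by linarith)) 0
      (right_mem_Icc.2 (by linarith)) (by linarith)
    rw [h0] at hmv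
    have := hcon T hT0
    linarith
  refine ⟨fun t => γ (t + -s), ⟨fun t => hγS _, fun t => ?_⟩, by simpa using hsR, s, hs, by
    simpa using h0⟩
  exact (hγ (t + -s)).comp_add_const t (-s)

end HypersurfaceFlow

/-! ### Submanifolds cut out by one complex equation -/

section ComplexEquations

variable {E : Type*} [NormedAddCommGroup E] [NormedSpace ℝ E]

/-- `f` is a local defining equation of `S` at `p`: a submersion to `ℂ` near `p` whose zero set
is `S`. -/
structure IsLocalEquation (S : Set E) (p : E) (f : E → ℂ) : Prop where
  exists_nhds : ∃ U : Set E, IsOpen U ∧ p ∈ U ∧ ContDiffOn ℝ ∞ f U ∧ ∀ x ∈ U, x ∈ S ↔ f x = 0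
  surjective : Function.Surjective (fderiv ℝ f p)

theorem isSmoothSubmanifold_of_isLocalEquation {S : Set E}
    (h : ∀ p ∈ S, ∃ f, IsLocalEquation S p f) : IsSmoothSubmanifold S := by
  refine ⟨2, fun p hp => ?_⟩
  obtain ⟨f, ⟨U, hU, hpU, hf, hS⟩, hsurj⟩ := h p hp
  let e : ℂ ≃L[ℝ] (Fin 2 → ℝ) := Complex.basisOneI.equivFun.toContinuousLinearEquiv
  refine ⟨U, hU, hpU, fun x => e (f x), e.contDiff.comp_contDiffOn hf, ?_, fun x hx => ?_⟩
  · have : fderiv ℝ (fun x => e (f x)) p = (e : ℂ →L[ℝ] (Fin 2 → ℝ)).comp (fderiv ℝ f p) :=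
      e.comp_fderiv
    rw [this]
    exact e.surjective.comp hsurj
  · rw [hS x hx]
    exact (map_eq_zero_iff e e.injective).symm

theorem mem_submanifoldTangent_iff [CompleteSpace E] {S : Set E} {p : E} {f : E → ℂ} (hp : p ∈ S)
    (h : IsLocalEquation S p f) (v : E) : v ∈ submanifoldTangent S p ↔ fderiv ℝ f p v = 0 := by
  obtain ⟨⟨U, hU, hpU, hf, hS⟩, hsurj⟩ := h
  have hfp : ContDiffAt ℝ ∞ f p := hf.contDiffAt (hU.mem_nhds hpU)
  have hd : DifferentiableAt ℝ f p := hfp.differentiableAt (by simp)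
  have hfS : ∀ᶠ x in 𝓝[S] p, f x = 0 := by
    filter_upwards [mem_nhdsWithin_of_mem_nhds (hU.mem_nhds hpU), self_mem_nhdsWithin] with x hx hxS
    exact (hS x hx).1 hxS
  constructor
  · intro hv
    have key : ∀ L : ℂ →L[ℝ] ℝ, L (fderiv ℝ f p v) = 0 := by
      intro L
      have h1 := hv (fun x => L (f x)) (L.contDiff.contDiffAt.comp p hfp)
        (hfS.mono fun x hx => by rw [hx, map_zero])
      have h2 : fderiv ℝ (fun x => L (f x)) p = L.comp (fderiv ℝ f p) :=
        (L.hasFDerivAt.comp p hd.hasFDerivAt).fderiv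
      rwa [h2] at h1
    exact Complex.ext (key Complex.reCLM) (key Complex.imCLM)
  · intro hv g hg hgS
    have hgp : g p = 0 := hgS.self_of_nhdsWithin hp
    have hfp0 : f p = 0 := (hS p hpU).1 hp
    -- Since `g` is constant on the level set of `f`, every point is a constrained extremum.
    -- Lagrange multipliers relate `dg` to `df`, and surjectivity of `df` makes the coefficient of
    -- `dg` nonzero.
    have hextr : IsLocalExtrOn g {x | f x = f p} p := by
      refine Or.inl ?_
      have : ∀ᶠ x in 𝓝[{x | f x = f p}] p, g x = 0 := by
        rw [eventually_nhdsWithin_iff] at hgS ⊢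
        filter_upwards [hgS, hU.mem_nhds hpU] with x hx hxU hfx
        exact hx ((hS x hxU).2 (by rw [← hfp0]; exact hfx))
      exact this.mono fun x hx => by rw [hx, hgp]
    obtain ⟨Λ, Λ₀, hne, hΛ⟩ := hextr.exists_linear_map_of_hasStrictFDerivAt
      (hfp.hasStrictFDerivAt (by simp)) (hg.hasStrictFDerivAt (by simp))
    have hΛ₀ : Λ₀ ≠ 0 := by
      rintro rfl
      apply hne
      have : Λ = 0 := by
        ext1 z
        obtain ⟨w, rfl⟩ := hsurj z
        simpa using hΛ w
      rw [this]; rfl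
    have h1 := hΛ v
    rw [hv, map_zero, zero_add, smul_eq_mul] at h1
    exact (mul_eq_zero.1 h1).resolve_left hΛ₀

end ComplexEquations

/-! ### Nonempty fibres and compact sublevel sets -/

section Hypersurfaces

variable {k : ℕ} (A : Finset (Fin k → ℤ))

/-- If a vertex coefficient vanished, the polynomial of that vertex would be zero and thus singular
everywhere. -/
theorem coeff_ne_zero_of_functional {α : A → ℂ} (hα : α ∉ principalLocus A) (l : Fin k → ℝ)
    (a₀ : A) (h : ∀ a : A, a ≠ a₀ → latticePoint a.1 ⬝ᵥ l < latticePoint a₀.1 ⬝ᵥ l) :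
    α a₀ ≠ 0 := by
  intro h0
  obtain ⟨Q, hQ, hface⟩ := exists_isNewtonFace_of_functional A l a₀ fun a => by
    by_cases ha : a = a₀
    · rw [ha]
    · exact (h a ha).le
  refine hα ⟨Q, hQ, ?_⟩
  have : faceCoeff A Q α = 0 := by
    ext a
    by_cases ha : a = a₀
    · simp [faceCoeff, Set.indicator, ha, h0]
    · simp [faceCoeff, Set.indicator, hface, (h a ha).ne]
  rw [this, hasTorusSingularity_iff]
  exact ⟨1, fun _ => one_ne_zero, by simp [laurentPoly], by ext; simp [logGrad]⟩

/-- An integral linear form that separates the points of a finite set. -/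
theorem exists_injOn_dotProduct : ∃ l : Fin k → ℤ, InjOn (fun a => a ⬝ᵥ l) (A : Set (Fin k → ℤ)) := by
  classical
  let F : (Fin k → ℤ) → Polynomial ℤ := fun c => ∑ i, Polynomial.C (c i) * Polynomial.X ^ (i : ℕ)
  have hF : ∀ c, c ≠ 0 → F c ≠ 0 := by
    intro c hc h0
    apply hc
    ext i
    have h1 : (F c).coeff (i : ℕ) = c i := by
      simp [F, Polynomial.finsetSum_coeff, Polynomial.coeff_X_pow, Fin.val_inj]
    rw [← h1, h0, Polynomial.coeff_zero, Pi.zero_apply]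
  have hP : ∏ p ∈ A.offDiag, F (p.1 - p.2) ≠ 0 := Finset.prod_ne_zero_iff.2 fun p hp =>
    hF _ (sub_ne_zero.2 (Finset.mem_offDiag.1 hp).2.2)
  obtain ⟨r, hr⟩ : ∃ r : ℤ, (∏ p ∈ A.offDiag, F (p.1 - p.2)).eval r ≠ 0 := by
    by_contra! h
    exact hP (Polynomial.funext fun r => by rw [h r, Polynomial.eval_zero])
  rw [Polynomial.eval_prod, Finset.prod_ne_zero_iff] at hr
  -- On the curve `(1, r, r², …)` a linear form is a polynomial in `r`; all differences of distinct
  -- points of `A` are avoided by one `r` that is not a root of their product.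
  refine ⟨fun i => r ^ (i : ℕ), fun a ha b hb hab => ?_⟩
  by_contra hne
  apply hr (a, b) (Finset.mem_offDiag.2 ⟨ha, hb, hne⟩)
  have h1 : (a - b) ⬝ᵥ (fun i : Fin k => r ^ (i : ℕ)) = 0 := by
    rw [sub_dotProduct]; exact sub_eq_zero.2 hab
  simpa [F, Polynomial.eval_finsetSum, dotProduct] using h1

theorem zpow_sum₀ {ι : Type*} {s : ℂ} (hs : s ≠ 0) (t : Finset ι) (f : ι → ℤ) :
    s ^ ∑ i ∈ t, f i = ∏ i ∈ t, s ^ f i := by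
  induction t using Finset.cons_induction with
  | empty => simp
  | cons a t ha ih => rw [Finset.sum_cons, Finset.prod_cons, zpow_add₀ hs, ih]

/-- Off the principal locus the hypersurface is nonempty. -/
theorem exists_mem_hypersurface (hA : 1 < A.card) {α : A → ℂ} (hα : α ∉ principalLocus A) :
    ∃ x ∈ complexTorus k, laurentPoly A α x = 0 := by
  classical
  obtain ⟨l, hl⟩ := exists_injOn_dotProduct A
  have hA0 : A.Nonempty := Finset.card_pos.1 (by omega)
  have : Nonempty A := hA0.to_subtype
  let e : A → ℤ := fun a => a.1 ⬝ᵥ l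
  have he : Function.Injective e := fun a b hab => Subtype.ext (hl a.2 b.2 hab)
  have hreal : ∀ a : A, latticePoint a.1 ⬝ᵥ (fun i => (l i : ℝ)) = (e a : ℝ) := fun a => by
    simp [e, dotProduct, latticePoint]
  obtain ⟨b, -, hb⟩ := Finset.exists_max_image (Finset.univ : Finset A) e Finset.univ_nonempty
  obtain ⟨c, -, hc⟩ := Finset.exists_min_image (Finset.univ : Finset A) e Finset.univ_nonempty
  have hbα : α b ≠ 0 := by
    refine coeff_ne_zero_of_functional A hα (fun i => (l i : ℝ)) b fun a ha => ?_
    rw [hreal, hreal]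
    exact_mod_cast lt_of_le_of_ne (hb a (Finset.mem_univ _)) (he.ne ha)
  have hcα : α c ≠ 0 := by
    refine coeff_ne_zero_of_functional A hα (-fun i => (l i : ℝ)) c fun a ha => ?_
    rw [dotProduct_neg, dotProduct_neg, hreal, hreal]
    exact_mod_cast neg_lt_neg (lt_of_le_of_ne (hc a (Finset.mem_univ _)) (he.ne ha.symm))
  have hbc : e c < e b := by
    obtain ⟨a, ha, a', ha', hne⟩ := Finset.one_lt_card.1 hA
    refine lt_of_le_of_ne (hc b (Finset.mem_univ _)) fun h => hne ?_
    have h1 : ∀ x : A, e x = e c := fun x =>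
      le_antisymm ((hb x (Finset.mem_univ _)).trans h.ge) (hc x (Finset.mem_univ _))
    exact congrArg Subtype.val (he ((h1 ⟨a, ha⟩).trans (h1 ⟨a', ha'⟩).symm))
  have hsub : ∀ a, 0 ≤ e a - e c := fun a => sub_nonneg.2 (hc a (Finset.mem_univ _))
  -- This is `f_α(s^l)` divided by its lowest power of `s`. Its constant term is nonzero and its
  -- degree positive, so it has a nonzero root.
  let p : Polynomial ℂ := ∑ a : A, Polynomial.C (α a) * Polynomial.X ^ (e a - e c).toNat
  have hcoeff : ∀ a, p.coeff (e a - e c).toNat = α a := by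
    intro a
    have h1 : ∀ x : A, (e a - e c).toNat = (e x - e c).toNat ↔ a = x := fun x => by
      have h2 := hsub a
      have h3 := hsub x
      rw [← he.eq_iff]
      omega
    simp only [p, Polynomial.finsetSum_coeff, Polynomial.coeff_C_mul, Polynomial.coeff_X_pow, h1]
    simp
  have hdeg : p.degree ≠ 0 := by
    have h1 := Polynomial.le_degree_of_ne_zero (p := p) (n := (e b - e c).toNat)
      (by rw [hcoeff]; exact hbα)
    intro h
    rw [h] at h1
    have h2 : (e b - e c).toNat ≤ 0 := by exact_mod_cast h1
    omega
  obtain ⟨s, hs⟩ := IsAlgClosed.exists_root p hdeg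
  have hs0 : s ≠ 0 := by
    rintro rfl
    rw [Polynomial.IsRoot, ← Polynomial.coeff_zero_eq_eval_zero] at hs
    have := hcoeff c
    rw [sub_self, Int.toNat_zero, hs] at this
    exact hcα this.symm
  refine ⟨fun i => s ^ l i, fun i => zpow_ne_zero _ hs0, ?_⟩
  have hmon : ∀ a : A, laurentMonomial a.1 (fun i => s ^ l i) =
      s ^ e c * s ^ (e a - e c).toNat := by
    intro a
    rw [← zpow_natCast, Int.toNat_of_nonneg (hsub a), ← zpow_add₀ hs0, add_sub_cancel,
      laurentMonomial]
    simp only [← zpow_mul, e, dotProduct, mul_comm (l _)]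
    exact (zpow_sum₀ hs0 _ _).symm
  rw [Polynomial.IsRoot, Polynomial.eval_finsetSum] at hs
  simp only [Polynomial.eval_mul, Polynomial.eval_C, Polynomial.eval_pow, Polynomial.eval_X] at hs
  simp only [laurentPoly_eq, hmon, mul_left_comm (α _), ← Finset.mul_sum, hs, mul_zero]

variable {q : QuadraticForm ℝ (Fin k → ℝ)}

/-- A bound on `ψ` bounds every `|log |x_i||`, which keeps `x` away from infinity and from the
coordinate hyperplanes. -/
theorem isCompact_toricPotential_le (hq : q.PosDef) (R : ℝ) :
    IsCompact {x | x ∈ complexTorus k ∧ toricPotential q x ≤ R} := by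
  obtain ⟨c, hc, h⟩ := exists_pos_mul_sq_le hq
  set r := √(R / c) with hr
  let B : Set (Fin k → ℂ) := univ.pi fun _ => {z | Real.exp (-r) ≤ ‖z‖ ∧ ‖z‖ ≤ Real.exp r}
  have hB : IsCompact B := by
    refine isCompact_univ_pi fun i => ?_
    refine (isCompact_closedBall (0 : ℂ) (Real.exp r)).of_isClosed_subset
      ((isClosed_le continuous_const continuous_norm).inter
        (isClosed_le continuous_norm continuous_const)) fun z hz => ?_
    simpa using hz.2
  have hBt : B ⊆ complexTorus k := fun x hx i h0 => by
    have := (hx i (mem_univ _)).1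
    rw [h0, norm_zero] at this
    exact absurd this (not_le.2 (Real.exp_pos _))
  have heq : {x | x ∈ complexTorus k ∧ toricPotential q x ≤ R} =
      B ∩ toricPotential q ⁻¹' Iic R := by
    ext x
    refine ⟨fun ⟨hx, hR⟩ => ⟨fun i _ => ?_, hR⟩, fun ⟨hx, hR⟩ => ⟨hBt hx, hR⟩⟩
    have h1 : ‖logAbs x‖ ≤ r := by
      refine Real.le_sqrt_of_sq_le ((le_div_iff₀' hc).2 ?_)
      exact (h _).trans hR
    have h2 := (norm_le_pi_norm (logAbs x) i).trans h1
    rw [Real.norm_eq_abs, abs_le] at h2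
    have hpos : 0 < ‖x i‖ := norm_pos_iff.2 (hx i)
    exact ⟨(Real.le_log_iff_exp_le hpos).1 h2.1, (Real.log_le_iff_le_exp hpos).1 h2.2⟩
  rw [heq]
  exact hB.of_isClosed_subset (((contDiffOn_toricPotential q).continuousOn.mono
    hBt).preimage_isClosed_of_isClosed hB.isClosed isClosed_Iic) inter_subset_left

end Hypersurfaces

/-! ### Liouville structure of the family and the Hermitian angle -/

section Assembly

variable {k : ℕ} (A : Finset (Fin k → ℤ)) {q : QuadraticForm ℝ (Fin k → ℝ)}

theorem logGrad_ne_zero {α : A → ℂ} {x : Fin k → ℂ} (hA : A.Nonempty)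
    (hx : x ∈ fibreAt (hypersurfaceFamily A) α) : logGrad A α x ≠ 0 := by
  intro h0
  obtain ⟨c, hc, h⟩ := exists_lower_bound A hA hx.1
  have h1 := h x hx.2.1
  rw [hx.2.2, h0, norm_zero, norm_zero, add_zero] at h1
  exact absurd h1 (not_le.2 (mul_pos hc (monomialSum_pos A hA hx.2.1)))

theorem exists_dotProduct_div_eq {d x : Fin k → ℂ} (hd : d ≠ 0) (hx : x ∈ complexTorus k)
    (c : ℂ) : ∃ v : Fin k → ℂ, d ⬝ᵥ (v / x) = c := by
  obtain ⟨i, hi⟩ := Function.ne_iff.1 hd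
  refine ⟨x * Pi.single i (c / d i), ?_⟩
  rw [mul_div_cancel_of_mem_complexTorus hx, dotProduct_single]
  exact mul_div_cancel₀ c hi

theorem fderiv_real_laurentPoly (α : A → ℂ) {x : Fin k → ℂ} (hx : x ∈ complexTorus k)
    (v : Fin k → ℂ) : fderiv ℝ (laurentPoly A α) x v = logGrad A α x ⬝ᵥ (v / x) := by
  have h := hasFDerivAt_laurentPoly A α hx
  rw [(h.restrictScalars ℝ).fderiv, ContinuousLinearMap.coe_restrictScalars', ← h.fderiv,
    fderiv_laurentPoly A α hx]
  rfl

theorem contDiffOn_laurentPoly_fibre (α : A → ℂ) :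
    ContDiffOn ℝ ∞ (laurentPoly A α) (complexTorus k) :=
  (contDiffOn_laurentPoly A).comp (contDiff_prodMk_right α).contDiffOn
    fun _ hx => ⟨mem_univ _, hx⟩

theorem isLocalEquation_fibre (hA : A.Nonempty) {α : A → ℂ} {x : Fin k → ℂ}
    (hx : x ∈ fibreAt (hypersurfaceFamily A) α) :
    IsLocalEquation (fibreAt (hypersurfaceFamily A) α) x (laurentPoly A α) where
  exists_nhds := ⟨complexTorus k, isOpen_complexTorus, hx.2.1, contDiffOn_laurentPoly_fibre A α,
    fun _ hy => ⟨fun h => h.2.2, fun h => ⟨hx.1, hy, h⟩⟩⟩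
  surjective := fun c => by
    obtain ⟨v, hv⟩ := exists_dotProduct_div_eq (logGrad_ne_zero A hA hx) hx.2.1 c
    exact ⟨v, by rw [fderiv_real_laurentPoly A α hx.2.1, hv]⟩

theorem isLocalEquation_total (hA : A.Nonempty) {V : Set (A → ℂ)} (hV : IsOpen V)
    {p : (A → ℂ) × (Fin k → ℂ)} (hp : p ∈ hypersurfaceFamily A ∩ Prod.fst ⁻¹' V) :
    IsLocalEquation (hypersurfaceFamily A ∩ Prod.fst ⁻¹' V) p
      fun p => laurentPoly A p.1 p.2 where
  exists_nhds := ⟨(V ∩ (principalLocus A)ᶜ) ×ˢ complexTorus k,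
    (hV.inter (isOpen_compl_principalLocus A hA)).prod isOpen_complexTorus,
    ⟨⟨hp.2, hp.1.1⟩, hp.1.2.1⟩,
    (contDiffOn_laurentPoly A).mono (prod_mono (subset_univ _) subset_rfl),
    fun _ hy => ⟨fun h => h.1.2.2, fun h => ⟨⟨hy.1.2, hy.2, h⟩, hy.1.1⟩⟩⟩
  surjective := fun c => by
    obtain ⟨v, hv⟩ := exists_dotProduct_div_eq (logGrad_ne_zero A hA (α := p.1) hp.1) hp.1.2.1 c
    refine ⟨(0, v), ?_⟩
    rw [fderiv_laurentPoly_prod A p hp.1.2.1]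
    simpa [laurentPoly, dotProduct] using hv

theorem mem_tangent_fibre_iff (hA : A.Nonempty) {α : A → ℂ} {x : Fin k → ℂ}
    (hx : x ∈ fibreAt (hypersurfaceFamily A) α) (v : Fin k → ℂ) :
    v ∈ submanifoldTangent (fibreAt (hypersurfaceFamily A) α) x ↔
      logGrad A α x ⬝ᵥ (v / x) = 0 := by
  rw [mem_submanifoldTangent_iff hx (isLocalEquation_fibre A hA hx),
    fderiv_real_laurentPoly A α hx.2.1]

theorem mem_tangent_total_iff (hA : A.Nonempty) {V : Set (A → ℂ)} (hV : IsOpen V)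
    {p : (A → ℂ) × (Fin k → ℂ)} (hp : p ∈ hypersurfaceFamily A ∩ Prod.fst ⁻¹' V)
    (v : (A → ℂ) × (Fin k → ℂ)) :
    v ∈ submanifoldTangent (hypersurfaceFamily A ∩ Prod.fst ⁻¹' V) p ↔
      laurentPoly A v.1 p.2 + logGrad A p.1 p.2 ⬝ᵥ (v.2 / p.2) = 0 := by
  rw [mem_submanifoldTangent_iff hp (isLocalEquation_total A hA hV hp),
    fderiv_laurentPoly_prod A p hp.1.2.1]
  rfl

theorem isExactSymplectic_fibre (hA : A.Nonempty) (hq : q.PosDef) (α : A → ℂ) :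
    IsExactSymplectic (fibreAt (hypersurfaceFamily A) α)
      (kahlerLiouvilleForm (toricPotential q)) where
  submanifold := isSmoothSubmanifold_of_isLocalEquation fun _ hx =>
    ⟨_, isLocalEquation_fibre A hA hx⟩
  smooth := ⟨complexTorus k, isOpen_complexTorus, fun _ hx => hx.2.1,
    contDiffOn_kahlerLiouvilleForm q⟩
  nondegenerate := by
    intro x hx v hv h
    rw [mem_tangent_fibre_iff A hA hx] at hv
    -- The tangent space is complex, so `v` may be tested against `i v`, which gives its squared
    -- length.
    have h1 := h (Complex.I • v) (by
      rw [mem_tangent_fibre_iff A hA hx, smul_div_pi, dotProduct_smul, hv, smul_zero])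
    have h2 : flatMetric q (v / x) (v / x) = 0 := by
      rw [← h1]
      exact (kahlerMetric_eq q hx.2.1 v v).symm
    by_contra hne
    refine (flatMetric_pos hq (ξ := v / x) fun h0 => hne ?_).ne' h2
    ext i
    exact (div_eq_zero_iff.1 (congrFun h0 i)).resolve_right (hx.2.1 i)

theorem isLiouvilleField_fibre (hA : A.Nonempty) (hq : q.PosDef) (α : A → ℂ) :
    IsLiouvilleField (fibreAt (hypersurfaceFamily A) α) (kahlerLiouvilleForm (toricPotential q))
      (hypersurfaceLiouvilleField A hq α) := by
  intro x hx
  refine ⟨?_, fun v hv => ?_⟩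
  · rw [mem_tangent_fibre_iff A hA hx, hypersurfaceLiouvilleField,
      mul_div_cancel_of_mem_complexTorus hx.2.1]
    exact logGrad_dotProduct_projectedGradient_eq_zero A hA hq hx.1 hx.2.1 hx.2.2
  · rw [mem_tangent_fibre_iff A hA hx] at hv
    rw [dOneForm_kahlerLiouvilleForm q hx.2.1, kahlerLiouvilleForm_apply q hx.2.1,
      hypersurfaceLiouvilleField, mul_div_cancel_of_mem_complexTorus hx.2.1]
    exact flatForm_projectedGradient A hq α x hv

/-- Outside a sublevel set of the potential, the potential increases along the Liouville field,
locally uniformly in the coefficients. -/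
theorem exists_sublevel (hA : A.Nonempty) (hq : q.PosDef) {α : A → ℂ}
    (hα : α ∉ principalLocus A) : ∃ V : Set (A → ℂ), IsOpen V ∧ α ∈ V ∧ V ⊆ (principalLocus A)ᶜ ∧
      ∃ R : ℝ, ∀ β ∈ V, ∀ y ∈ fibreAt (hypersurfaceFamily A) β, R ≤ toricPotential q y →
        1 ≤ fderiv ℝ (toricPotential q) y (hypersurfaceLiouvilleField A hq β y) := by
  obtain ⟨V, hV, hαV, hsub, D, hD, h⟩ := exists_normal_component_le A hA hq hα
  -- The threshold solves `2R - D = 1`.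
  refine ⟨V, hV, hαV, hsub, (D + 1) / 2, fun β hβ y hy hR => ?_⟩
  obtain ⟨hd, hle⟩ := h β hβ y hy.2.1 hy.2.2
  have := fderiv_toricPotential_liouvilleField_ge A hq hy.2.1 hy.2.2 hd hle
  linarith

theorem continuousAt_toricPotential {x : Fin k → ℂ} (hx : x ∈ complexTorus k) :
    ContinuousAt (toricPotential q) x :=
  (contDiffOn_toricPotential q).continuousOn.continuousAt (isOpen_complexTorus.mem_nhds hx)

theorem isCompact_sublevel_total (hq : q.PosDef) (R : ℝ) {K : Set (A → ℂ)}
    (hK : IsCompact K) (hKV : K ⊆ (principalLocus A)ᶜ) :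
    IsCompact {p : (A → ℂ) × (Fin k → ℂ) | p ∈ hypersurfaceFamily A ∧ p.1 ∈ K ∧
      toricPotential q p.2 ≤ R} := by
  have hc := hK.prod (isCompact_toricPotential_le hq R)
  have hcont : ContinuousOn (fun p : (A → ℂ) × (Fin k → ℂ) => laurentPoly A p.1 p.2)
      (K ×ˢ {x | x ∈ complexTorus k ∧ toricPotential q x ≤ R}) :=
    (contDiffOn_laurentPoly A).continuousOn.mono fun p hp => ⟨mem_univ _, hp.2.1⟩
  refine hc.of_isClosed_subset (s := _) ?_ fun p hp => ⟨hp.2.1, hp.1.2.1, hp.2.2⟩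
  have h := hcont.preimage_isClosed_of_isClosed hc.isClosed (isClosed_singleton (x := (0 : ℂ)))
  convert h using 1
  ext p
  exact ⟨fun hp => ⟨⟨hp.2.1, hp.1.2.1, hp.2.2⟩, hp.1.2.2⟩,
    fun hp => ⟨⟨hKV hp.1.1, hp.1.2.1, hp.2⟩, hp.1.1, hp.1.2.2⟩⟩

theorem isBoundaryDefining_sublevel_fibre (hA : A.Nonempty) (hq : q.PosDef) {α : A → ℂ} {R : ℝ}
    (hR : ∀ y ∈ fibreAt (hypersurfaceFamily A) α, R ≤ toricPotential q y →
      1 ≤ fderiv ℝ (toricPotential q) y (hypersurfaceLiouvilleField A hq α y))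
    {p : Fin k → ℂ} (hp : p ∈ relBoundary (fibreAt (hypersurfaceFamily A) α)
      {x | x ∈ fibreAt (hypersurfaceFamily A) α ∧ toricPotential q x ≤ R}) :
    IsBoundaryDefining (fibreAt (hypersurfaceFamily A) α)
        {x | x ∈ fibreAt (hypersurfaceFamily A) α ∧ toricPotential q x ≤ R} p
        (fun x => toricPotential q x - R) ∧
      0 < fderiv ℝ (fun x => toricPotential q x - R) p (hypersurfaceLiouvilleField A hq α p) := by
  obtain ⟨⟨hpS, hpR⟩, hnot⟩ := hp
  -- A point with `ψ < R` is interior, so the relative boundary lies in `{ψ = R}`.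
  have hge : R ≤ toricPotential q p := by
    by_contra! hlt
    apply hnot
    filter_upwards [mem_nhdsWithin_of_mem_nhds
      ((continuousAt_toricPotential hpS.2.1).eventually_lt_const hlt), self_mem_nhdsWithin]
      with x hx hxS using ⟨hxS, hx.le⟩
  have hpos : 0 < fderiv ℝ (fun x => toricPotential q x - R) p
      (hypersurfaceLiouvilleField A hq α p) := by
    rw [fderiv_sub_const]
    exact one_pos.trans_le (hR p hpS hge)
  exact ⟨⟨sub_eq_zero.2 (le_antisymm hpR hge),
    ⟨_, (isLiouvilleField_fibre A hA hq α p hpS).1, hpos.ne'⟩, complexTorus k, isOpen_complexTorus,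
    hpS.2.1, (contDiffOn_toricPotential q).sub contDiffOn_const, fun x hx =>
      ⟨fun h => sub_nonpos.2 h.2, fun h => ⟨hx.2, sub_nonpos.1 h⟩⟩⟩, hpos⟩

theorem isGeneratingLiouvilleDomain_sublevel (hA : A.Nonempty) (hq : q.PosDef) {α : A → ℂ}
    (hα : α ∉ principalLocus A) {R : ℝ}
    (hR : ∀ y ∈ fibreAt (hypersurfaceFamily A) α, R ≤ toricPotential q y →
      1 ≤ fderiv ℝ (toricPotential q) y (hypersurfaceLiouvilleField A hq α y)) :
    IsGeneratingLiouvilleDomain (fibreAt (hypersurfaceFamily A) α)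
      (kahlerLiouvilleForm (toricPotential q))
      {x | x ∈ fibreAt (hypersurfaceFamily A) α ∧ toricPotential q x ≤ R} := by
  refine ⟨?_, ⟨fun _ hx => hx.1, fun p hp =>
    ⟨_, (isBoundaryDefining_sublevel_fibre A hA hq hR hp).1⟩⟩, _,
    isLiouvilleField_fibre A hA hq α, fun p hp =>
      ⟨_, isBoundaryDefining_sublevel_fibre A hA hq hR hp⟩, fun x hx => ?_⟩
  · have h := (isCompact_sublevel_total A hq R (isCompact_singleton (x := α))
      (singleton_subset_iff.2 hα)).image continuous_snd
    refine Eq.subst (motive := IsCompact) (Set.ext fun x => ?_) h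
    refine Iff.symm ⟨?_, ?_⟩
    · exact fun hx => ⟨(α, x), ⟨hx.1, rfl, hx.2⟩, rfl⟩
    · rintro ⟨⟨β, y⟩, ⟨hy, hβ, hyR⟩, rfl⟩
      cases hβ
      exact ⟨hy, hyR⟩
  · obtain ⟨γ, hγ, h0, ht⟩ := exists_isFlowLine_of_sublevel A hA hq hR hx
    exact ⟨γ, hγ, ⟨hγ.1 0, h0⟩, ht⟩

theorem isLiouvilleManifold_fibre (hA : A.Nonempty) (hq : q.PosDef) {α : A → ℂ}
    (hα : α ∉ principalLocus A) : IsLiouvilleManifold (fibreAt (hypersurfaceFamily A) α)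
      (kahlerLiouvilleForm (toricPotential q)) where
  exactSymplectic := isExactSymplectic_fibre A hA hq α
  complete := ⟨_, isLiouvilleField_fibre A hA hq α, fun _ hx => exists_isFlowLine A hA hq hx⟩
  generated := by
    obtain ⟨V, -, hαV, -, R, hR⟩ := exists_sublevel A hA hq hα
    exact ⟨_, isGeneratingLiouvilleDomain_sublevel A hA hq hα (hR α hαV)⟩

theorem isLiouvilleFamily_hypersurfaceFamily (hA : 1 < A.card) (hq : q.PosDef) :
    IsLiouvilleFamily (principalLocus A)ᶜ (hypersurfaceFamily A)
      (fun _ => kahlerLiouvilleForm (toricPotential q)) := by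
  have hA0 : A.Nonempty := Finset.card_pos.1 (by omega)
  have huniv : hypersurfaceFamily A = hypersurfaceFamily A ∩ Prod.fst ⁻¹' univ := by simp
  refine ⟨isOpen_compl_principalLocus A hA0, ?_, ?_, ?_, ?_, fun α hα =>
    isLiouvilleManifold_fibre A hA0 hq hα⟩
  · rw [huniv]
    exact isSmoothSubmanifold_of_isLocalEquation fun p hp =>
      ⟨_, isLocalEquation_total A hA0 isOpen_univ hp⟩
  · ext α
    constructor
    · rintro ⟨p, hp, rfl⟩
      exact hp.1
    · intro hα
      obtain ⟨x, hx, hf⟩ := exists_mem_hypersurface A hA hα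
      exact ⟨(α, x), ⟨hα, hx, hf⟩, rfl⟩
  · intro p hp u
    -- A variation `u` of the coefficients changes the value of `f` by `f_u(x)`; a motion of `x`
    -- compensates it because the logarithmic gradient is nonzero.
    obtain ⟨v, hv⟩ := exists_dotProduct_div_eq (logGrad_ne_zero A hA0 (α := p.1) hp) hp.2.1
      (-laurentPoly A u p.2)
    refine ⟨(u, v), ?_, rfl⟩
    rw [huniv] at hp ⊢
    rw [mem_tangent_total_iff A hA0 isOpen_univ hp, hv, add_neg_cancel]
  · exact ⟨univ ×ˢ complexTorus k, isOpen_univ.prod isOpen_complexTorus,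
      fun p hp => ⟨mem_univ _, hp.2.1⟩,
      (contDiffOn_kahlerLiouvilleForm q).comp contDiffOn_snd fun p hp => hp.2⟩

theorem locallyHasGeneratingDomains_hypersurfaceFamily (hA : A.Nonempty) (hq : q.PosDef) :
    LocallyHasGeneratingDomains (principalLocus A)ᶜ (hypersurfaceFamily A)
      (fun _ => kahlerLiouvilleForm (toricPotential q)) := by
  intro α hα
  obtain ⟨V, hV, hαV, hsub, R, hR⟩ := exists_sublevel A hA hq hα
  refine ⟨V, hsub, hV, hαV, {p | p ∈ hypersurfaceFamily A ∧ p.1 ∈ V ∧ toricPotential q p.2 ≤ R},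
    ⟨fun p hp => ⟨hp.1, hp.2.1⟩, ?_⟩, ?_, ?_⟩
  · rintro p ⟨⟨hpN, hpV, hpR⟩, hnot⟩
    have hge : R ≤ toricPotential q p.2 := by
      by_contra! hlt
      apply hnot
      have hc : ContinuousAt (fun p : (A → ℂ) × (Fin k → ℂ) => toricPotential q p.2) p :=
        (continuousAt_toricPotential hpN.2.1).comp continuousAt_snd
      filter_upwards [mem_nhdsWithin_of_mem_nhds (hc.eventually_lt_const hlt),
        self_mem_nhdsWithin] with y hy hyN using ⟨hyN.1, hyN.2, hy.le⟩
    -- The vertical lift `(0, Z)` of the fibre field is tangent to the total space and already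
    -- detects that `dψ` is nonzero there.
    have hfd : fderiv ℝ (fun p : (A → ℂ) × (Fin k → ℂ) => toricPotential q p.2 - R) p
        (0, hypersurfaceLiouvilleField A hq p.1 p.2) =
        fderiv ℝ (toricPotential q) p.2 (hypersurfaceLiouvilleField A hq p.1 p.2) := by
      have hd : DifferentiableAt ℝ (toricPotential q) p.2 :=
        ((contDiffOn_toricPotential q).contDiffAt
          (isOpen_complexTorus.mem_nhds hpN.2.1)).differentiableAt (by simp)
      have h := (hd.hasFDerivAt.comp p hasFDerivAt_snd).fderiv
      rw [fderiv_sub_const]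
      simp only [Function.comp_def] at h
      rw [h]
      rfl
    refine ⟨fun p => toricPotential q p.2 - R, sub_eq_zero.2 (le_antisymm hpR hge),
      ⟨(0, hypersurfaceLiouvilleField A hq p.1 p.2), ?_, ?_⟩,
      univ ×ˢ complexTorus k, isOpen_univ.prod isOpen_complexTorus, ⟨mem_univ _, hpN.2.1⟩,
      ((contDiffOn_toricPotential q).comp contDiffOn_snd fun _ hy => hy.2).sub contDiffOn_const,
      fun y hy => ⟨fun h => sub_nonpos.2 h.2.2, fun h => ⟨hy.2.1, hy.2.2, sub_nonpos.1 h⟩⟩⟩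
    · rw [mem_tangent_total_iff A hA hV ⟨hpN, hpV⟩,
        (mem_tangent_fibre_iff A hA (α := p.1) hpN _).1
          (isLiouvilleField_fibre A hA hq p.1 p.2 hpN).1]
      simp [laurentPoly]
    · rw [hfd]
      exact (one_pos.trans_le (hR p.1 hpV p.2 hpN hge)).ne'
  · intro K hKV hK
    convert isCompact_sublevel_total A hq R hK (hKV.trans hsub) using 1
    ext p
    exact ⟨fun hp => ⟨hp.1.1, hp.2, hp.1.2.2⟩, fun hp => ⟨⟨hp.1, hKV hp.2.1, hp.2.2⟩, hp.2.1⟩⟩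
  · intro β hβ
    have heq : fibreAt {p : (A → ℂ) × (Fin k → ℂ) | p ∈ hypersurfaceFamily A ∧ p.1 ∈ V ∧
        toricPotential q p.2 ≤ R} β =
        {x | x ∈ fibreAt (hypersurfaceFamily A) β ∧ toricPotential q x ≤ R} := by
      ext x
      exact ⟨fun hx => ⟨hx.1, hx.2.2⟩, fun hx => ⟨hx.1, hβ, hx.2⟩⟩
    rw [heq]
    exact isGeneratingLiouvilleDomain_sublevel A hA hq (hsub hβ) (hR β hβ)

theorem kahlerMetric_eq_flatMetric {x : Fin k → ℂ} (hx : x ∈ complexTorus k) (v w : Fin k → ℂ) :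
    kahlerMetric (toricPotential q) x v w = flatMetric q (v / x) (w / x) :=
  kahlerMetric_eq q hx v w

theorem kahlerHermitian_hermDual (hq : q.PosDef) (d : Fin k → ℂ) {x : Fin k → ℂ}
    (hx : x ∈ complexTorus k) (v : Fin k → ℂ) :
    kahlerHermitian (toricPotential q) x v (x * hermDual hq d) = d ⬝ᵥ (v / x) := by
  have h1 : kahlerForm (toricPotential q) x v (x * hermDual hq d) =
      flatForm q (v / x) (hermDual hq d) := by
    rw [kahlerForm_eq q hx, mul_div_cancel_of_mem_complexTorus hx]; rfl
  rw [kahlerHermitian, kahlerMetric_eq_flatMetric hx, h1, mul_div_cancel_of_mem_complexTorus hx,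
    flatMetric_hermDual, flatForm_hermDual]
  apply Complex.ext <;> simp

/-- The Hermitian angle between the gradient of the potential and the derivative of the
polynomial, locally uniformly in the coefficients. -/
theorem exists_isCompact_lt_hermitianAngle_nhds (hA : A.Nonempty) (hq : q.PosDef) {α : A → ℂ}
    (hα : α ∉ principalLocus A) {δ : ℝ} (hδ : δ < Real.pi / 2) :
    ∃ V ∈ 𝓝 α, ∃ C : Set (Fin k → ℂ), IsCompact C ∧ C ⊆ complexTorus k ∧
      ∀ β ∈ V, ∀ x ∈ complexTorus k \ C, laurentPoly A β x = 0 →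
        ∃ Z X : Fin k → ℂ, Z ≠ 0 ∧ X ≠ 0 ∧ IsKahlerGradient (toricPotential q) x Z ∧
          IsHermitianDual (toricPotential q) x (fderiv ℂ (laurentPoly A β) x) X ∧
          δ < hermitianAngle (toricPotential q) x Z X := by
  obtain ⟨V, hV, hαV, hsub, D, hD, h⟩ := exists_normal_component_le A hA hq hα
  obtain ⟨ε, hε, hεδ⟩ : ∃ ε > 0, ∀ t : ℝ, |t| < ε → δ < Real.arccos t := by
    have hev : ∀ᶠ t in 𝓝 (0 : ℝ), δ < Real.arccos t :=
      Real.continuous_arccos.continuousAt.eventually_const_lt (by rwa [Real.arccos_zero])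
    obtain ⟨ε, hε, hb⟩ := Metric.eventually_nhds_iff.1 hev
    exact ⟨ε, hε, fun t ht => hb (by rwa [Real.dist_0_eq_abs])⟩
  -- The squared cosine is at most `D / (2ψ)`, hence below `ε²` once `ψ > D / ε²`.
  refine ⟨V, hV.mem_nhds hαV, _, isCompact_toricPotential_le hq (D / ε ^ 2),
    fun x hx => hx.1, fun β hβ x hx hf => ?_⟩
  obtain ⟨hxt, hxC⟩ := hx
  have hψ : D / ε ^ 2 < toricPotential q x := not_le.1 fun hle => hxC ⟨hxt, hle⟩
  have hψ0 : 0 < toricPotential q x := lt_of_le_of_lt (by positivity) hψ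
  obtain ⟨hd, hle⟩ := h β hβ x hxt hf
  have hN := dualNormSq_pos hq hd
  have hmul0 : ∀ v : Fin k → ℂ, x * v = 0 → v = 0 := fun v hv => by
    rw [← mul_div_cancel_of_mem_complexTorus hxt v, hv]; ext i; simp
  have hZZ : kahlerMetric (toricPotential q) x (x * logRadial x) (x * logRadial x) =
      2 * toricPotential q x := by
    rw [kahlerMetric_eq_flatMetric hxt, mul_div_cancel_of_mem_complexTorus hxt]
    simp [flatMetric, polarForm_self, toricPotential_eq]
  refine ⟨x * logRadial x, x * hermDual hq (logGrad A β x), fun h0 => ?_, fun h0 => ?_,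
    fun w => ?_, fun v => ?_, hεδ _ ?_⟩
  · have h1 := hmul0 _ h0
    have h2 : logAbs x = 0 := by rw [← rePart_logRadial, h1, map_zero]
    rw [toricPotential_eq, h2, QuadraticMap.map_zero] at hψ0
    exact lt_irrefl _ hψ0
  · have h1 := hmul0 _ h0
    rw [dualNormSq, h1] at hN
    simp [flatMetric] at hN
  · rw [kahlerMetric_eq_flatMetric hxt, mul_div_cancel_of_mem_complexTorus hxt,
      fderiv_toricPotential q hxt]
    simp [flatMetric]
  · rw [kahlerHermitian_hermDual hq _ hxt, fderiv_laurentPoly A β hxt]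
    rfl
  · have hXX : kahlerMetric (toricPotential q) x (x * hermDual hq (logGrad A β x))
        (x * hermDual hq (logGrad A β x)) = dualNormSq hq (logGrad A β x) := by
      rw [kahlerMetric_eq_flatMetric hxt, mul_div_cancel_of_mem_complexTorus hxt]
      rfl
    rw [kahlerHermitian_hermDual hq _ hxt, mul_div_cancel_of_mem_complexTorus hxt, hZZ, hXX,
      abs_of_nonneg (by positivity), div_lt_iff₀ (by positivity),
      ← Real.sqrt_mul (by positivity), ← Real.sqrt_sq hε.le, ← Real.sqrt_mul (by positivity)]
    refine Real.lt_sqrt_of_sq_lt (hle.trans_lt ?_)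
    rw [div_lt_iff₀ (by positivity)] at hψ
    nlinarith [mul_pos hψ0 (pow_pos hε 2)]

theorem exists_isCompact_lt_hermitianAngle (hA : A.Nonempty) (hq : q.PosDef) {K : Set (A → ℂ)}
    (hKV : K ⊆ (principalLocus A)ᶜ) (hK : IsCompact K) {δ : ℝ} (hδ : δ < Real.pi / 2) :
    ∃ C : Set (Fin k → ℂ), IsCompact C ∧ C ⊆ complexTorus k ∧
      ∀ α ∈ K, ∀ x ∈ complexTorus k \ C, laurentPoly A α x = 0 →
        ∃ Z X : Fin k → ℂ, Z ≠ 0 ∧ X ≠ 0 ∧ IsKahlerGradient (toricPotential q) x Z ∧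
          IsHermitianDual (toricPotential q) x (fderiv ℂ (laurentPoly A α) x) X ∧
          δ < hermitianAngle (toricPotential q) x Z X := by
  refine hK.induction_on ?_ ?_ ?_ ?_
  · exact ⟨∅, isCompact_empty, empty_subset _, by simp⟩
  · rintro s t hst ⟨C, hC, hCt, h⟩
    exact ⟨C, hC, hCt, fun α hα => h α (hst hα)⟩
  · rintro s t ⟨C, hC, hCt, h⟩ ⟨C', hC', hCt', h'⟩
    refine ⟨C ∪ C', hC.union hC', union_subset hCt hCt', ?_⟩
    rintro α (hα | hα) x ⟨hx, hxC⟩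
    · exact h α hα x ⟨hx, fun hx' => hxC (Or.inl hx')⟩
    · exact h' α hα x ⟨hx, fun hx' => hxC (Or.inr hx')⟩
  · intro α hα
    obtain ⟨V, hV, C, hC⟩ := exists_isCompact_lt_hermitianAngle_nhds A hA hq (hKV hα) hδ
    exact ⟨V, mem_nhdsWithin_of_mem_nhds hV, C, hC⟩

end Assembly

end

theorem mainTheorem9 {k : ℕ} (A : Finset (Fin k → ℤ)) (hA : 1 < A.card)
    (q : QuadraticForm ℝ (Fin k → ℝ)) (hq : q.PosDef) :
    IsLiouvilleFamily (principalLocus A)ᶜ (hypersurfaceFamily A)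
      (fun _ => kahlerLiouvilleForm (toricPotential q)) ∧
    LocallyHasGeneratingDomains (principalLocus A)ᶜ (hypersurfaceFamily A)
      (fun _ => kahlerLiouvilleForm (toricPotential q)) ∧
    ∀ K : Set (A → ℂ), K ⊆ (principalLocus A)ᶜ → IsCompact K →
      ∀ δ : ℝ, δ < Real.pi / 2 →
        ∃ C : Set (Fin k → ℂ), IsCompact C ∧ C ⊆ complexTorus k ∧
          ∀ α ∈ K, ∀ x ∈ complexTorus k \ C, laurentPoly A α x = 0 →
            ∃ Z X : Fin k → ℂ, Z ≠ 0 ∧ X ≠ 0 ∧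
              IsKahlerGradient (toricPotential q) x Z ∧
              IsHermitianDual (toricPotential q) x (fderiv ℂ (laurentPoly A α) x) X ∧
              δ < hermitianAngle (toricPotential q) x Z X := by
  have hA0 : A.Nonempty := Finset.card_pos.1 (by omega)
  exact ⟨isLiouvilleFamily_hypersurfaceFamily A hA hq,
    locallyHasGeneratingDomains_hypersurfaceFamily A hA0 hq,
    fun K hKV hK δ hδ => exists_isCompact_lt_hermitianAngle A hA0 hq hKV hK hδ⟩
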